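/- **Theorem 1 (Nonlinear stability of steady solutions of the GHM equation).** Let $\lambda,\sigma>0$ be constants, let $\Omega\subset\mathbb{R}^3$ be a bounded open set, and let $\boldsymbol{B}:\overline\Omega\to\mathbb{R}^3$ and $A_e:\overline\Omega\to\mathbb{R}$ be of class $C^2(\overline\Omega)$ with $\min_{\overline\Omega}|\boldsymbol{B}|>0$ and $\min_{\overline\Omega}A_e>0$. (A function is of class $C^k$ up to the boundary if it is $C^k$ in the interior and it and its derivatives up to order $k$ extend continuously to the boundary.) Write $B=|\boldsymbol{B}|$, $$\nabla_\perp\chi=-\frac{\boldsymbol{B}\times(\boldsymbol{B}\times\nabla\chi)}{B^2},\qquad \boldsymbol{v}_{\boldsymbol{E}}^{\chi}=\frac{\boldsymbol{B}\times\nabla\chi}{B^2},\qquad \mathcal{D}\chi=\lambda A_e\chi-\sigma\nabla\cdot\Big(A_e\frac{\nabla_\perp\chi}{B^2}\Big).$$ The generalized Hasegawa–Mima (GHM) equation is $$\frac{\partial}{\partial t}\mathcal{D}\chi=\nabla\cdot\Big[A_e\Big(\sigma\frac{\boldsymbol{B}\cdot\nabla\times\boldsymbol{v}_{\boldsymbol{E}}^{\chi}}{B^2}-1\Big)\boldsymbol{v}_{\boldsymbol{E}}^{\chi}\Big].$$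 By a global classical solution we mean a function $\chi\in C^2(\overline\Omega\times[0,\infty))$ such that the vector field in square brackets is differentiable in $\Omega$ at every time, the equation holds at every point of $\Omega\times[0,\infty)$, and its two sides extend continuously to $\overline\Omega\times[0,\infty)$. For $\gamma,\nu\in\mathbb{R}$ and $w:\mathbb{R}\to\mathbb{R}$ let $\mathfrak{H}_\Omega=H_\Omega+\gamma M_\Omega+\nu W_\Omega$, where $$M_\Omega=\int_\Omega A_e(1+\lambda\chi)\,d\boldsymbol{x},\quad H_\Omega=\frac12\int_\Omega A_e\Big(\lambda\chi^2+\sigma\frac{|\nabla_\perp\chi|^2}{B^2}\Big)d\boldsymbol{x},\quad W_\Omega=\int_\Omega A_e\,w\Big(\frac{\mathcal{D}\chi}{A_e}\Big)d\boldsymbol{x}.$$ Suppose that * if $\nabla\times(A_e\boldsymbol{B}/B^2)=\boldsymbol{0}$ in $\Omega$, then $w$ is twice differentiable and $0<c_m\le\nu w''\le c_M<\infty$ on $\mathbb{R}$ for some constants $c_m,c_M$; * if $\nabla\times(A_e\boldsymbol{B}/B^2)\not\equiv\boldsymbol{0}$ in $\Omega$, then $\nu=0$. Let $\chi_0\in C^2(\overline\Omega)$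 be a critical point of $\mathfrak{H}_\Omega$, that is, $\frac{d}{ds}\mathfrak{H}_\Omega[\chi_0+sh]\big|_{s=0}=0$ for every $h\in C^2(\overline\Omega)$ with $h=0$ on $\partial\Omega$, and suppose that $A_e(\chi_0+\gamma)=0$ on $\partial\Omega$ (since $A_e>0$ on $\overline\Omega$, this means $\chi_0=-\gamma$ on $\partial\Omega$). Then $\chi_0$ is nonlinearly stable: there is a constant $\mathfrak{C}>0$ such that every global classical solution $\chi$ of the GHM equation with $\chi(t)=\chi_0$ on $\partial\Omega$ for all $t\ge0$ satisfies $$\|\chi(t)-\chi_0\|_\perp^2\le\mathfrak{C}\,\|\chi(0)-\chi_0\|_\perp^2\qquad\text{for all }t\ge0,$$ where $\|\chi\|_\perp^2=\|\chi\|^2_{L^2(\Omega)}+\|\nabla_\perp\chi\|^2_{L^2(\Omega)}+\|\mathcal{D}\chi\|^2_{L^2(\Omega)}$ if $\nabla\times(A_e\boldsymbol{B}/B^2)=\boldsymbol{0}$ in $\Omega$, and $\|\chi\|_\perp^2=\|\chi\|^2_{L^2(\Omega)}+\|\nabla_\perp\chi\|^2_{L^2(\Omega)}$ otherwise. -/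

import Mathlib

open MeasureTheory Set

noncomputable section

namespace GHM

/-- Physical space `ℝ³` with its Euclidean norm. -/
abbrev E3 : Type := EuclideanSpace ℝ (Fin 3)

/-- The cross product on `ℝ³`. -/
def cross (u v : E3) : E3 :=
  WithLp.toLp 2 (crossProduct (WithLp.ofLp u) (WithLp.ofLp v))

/-- The partial derivative `∂ F_j / ∂ x_i` of a vector field. -/
def pd (F : E3 → E3) (i j : Fin 3) (x : E3) : ℝ :=
  fderiv ℝ F x (EuclideanSpace.single i 1) j

/-- The divergence of a vector field. -/
def dive (F : E3 → E3) (x : E3) : ℝ := ∑ i, pd F i i x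

/-- The curl of a vector field. -/
def curl (F : E3 → E3) (x : E3) : E3 :=
  !₂[pd F 1 2 x - pd F 2 1 x, pd F 2 0 x - pd F 0 2 x, pd F 0 1 x - pd F 1 0 x]

/-- `f` is of class `Cⁿ` on `s` up to the boundary: `f` is continuous on the closure of `s`, it is
`Cⁿ` on `s`, and its derivatives up to order `n` extend continuously to the closure of `s`. -/
def ContDiffUpTo {X Y : Type*} [NormedAddCommGroup X] [NormedSpace ℝ X] [NormedAddCommGroup Y]
    [NormedSpace ℝ Y] (n : ℕ) (f : X → Y) (s : Set X) : Prop :=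
  ContinuousOn f (closure s) ∧
    ∃ p : X → FormalMultilinearSeries ℝ X Y, HasFTaylorSeriesUpToOn n f p s ∧
      ∀ m ≤ n, ContinuousOn (fun x => p x m) (closure s)

/-- The perpendicular gradient `∇_⊥ χ = - B⁻² B × (B × ∇χ)`. -/
def gradPerp (B : E3 → E3) (χ : E3 → ℝ) (x : E3) : E3 :=
  -((‖B x‖ ^ 2)⁻¹ • cross (B x) (cross (B x) (gradient χ x)))

/-- The drift velocity `v_E^χ = B × ∇χ / B²`. -/
def vE (B : E3 → E3) (χ : E3 → ℝ) (x : E3) : E3 :=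
  (‖B x‖ ^ 2)⁻¹ • cross (B x) (gradient χ x)

/-- The operator `𝒟χ = lam A_e χ - σ ∇ · (A_e ∇_⊥ χ / B²)`. -/
def opD (lam σ : ℝ) (Ae : E3 → ℝ) (B : E3 → E3) (χ : E3 → ℝ) (x : E3) : ℝ :=
  lam * Ae x * χ x - σ * dive (fun y => (Ae y / ‖B y‖ ^ 2) • gradPerp B χ y) x

/-- The vector field `A_e (σ B · ∇ × v_E^χ / B² - 1) v_E^χ`, whose divergence is the right-hand side
of the GHM equation. -/
def flux (σ : ℝ) (Ae : E3 → ℝ) (B : E3 → E3) (χ : E3 → ℝ) (x : E3) : E3 :=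
  (Ae x * (σ * (inner ℝ (B x) (curl (vE B χ) x) / ‖B x‖ ^ 2) - 1)) • vE B χ x

/-- `χ` (time first, then space) is a global classical solution, regular up to the boundary, of the
GHM equation `∂ₜ (𝒟χ) = ∇ · [A_e (σ B · ∇ × v_E^χ / B² - 1) v_E^χ]` in `Ω × [0, ∞)`. -/
structure IsSolution (lam σ : ℝ) (Ω : Set E3) (Ae : E3 → ℝ) (B : E3 → E3) (χ : ℝ → E3 → ℝ) :
    Prop where
  /-- `χ` is `C²` in `(t, x)` up to the boundary. -/
  contDiff : ContDiffUpTo 2 (Function.uncurry χ) (Ici (0 : ℝ) ×ˢ Ω)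
  /-- The divergence on the right-hand side is that of a differentiable vector field. -/
  flux_diff : ∀ t, 0 ≤ t → DifferentiableOn ℝ (flux σ Ae B (χ t)) Ω
  /-- The equation holds at every point (with a one-sided time derivative at `t = 0`). -/
  equation : ∀ t, 0 ≤ t → ∀ x ∈ Ω,
    HasDerivWithinAt (fun s => opD lam σ Ae B (χ s) x) (dive (flux σ Ae B (χ t)) x) (Ici 0) t
  /-- The two (equal) sides of the equation are continuous up to the boundary. -/
  rhs_cont : ∃ g : ℝ × E3 → ℝ, ContinuousOn g (Ici (0 : ℝ) ×ˢ closure Ω) ∧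
    ∀ t, 0 ≤ t → ∀ x ∈ Ω, g (t, x) = dive (flux σ Ae B (χ t)) x

/-- The mass `M_Ω`. -/
def mass (lam : ℝ) (Ω : Set E3) (Ae : E3 → ℝ) (χ : E3 → ℝ) : ℝ :=
  ∫ x in Ω, Ae x * (1 + lam * χ x)

/-- The energy `H_Ω`. -/
def energy (lam σ : ℝ) (Ω : Set E3) (Ae : E3 → ℝ) (B : E3 → E3) (χ : E3 → ℝ) : ℝ :=
  (1 / 2) * ∫ x in Ω, Ae x * (lam * χ x ^ 2 + σ * (‖gradPerp B χ x‖ ^ 2 / ‖B x‖ ^ 2))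

/-- The generalized enstrophy `W_Ω`. -/
def enstrophy (lam σ : ℝ) (Ω : Set E3) (Ae : E3 → ℝ) (B : E3 → E3) (w : ℝ → ℝ)
    (χ : E3 → ℝ) : ℝ :=
  ∫ x in Ω, Ae x * w (opD lam σ Ae B χ x / Ae x)

/-- The energy-Casimir functional `H_Ω + γ M_Ω + ν W_Ω`. -/
def energyCasimir (lam σ : ℝ) (Ω : Set E3) (Ae : E3 → ℝ) (B : E3 → E3) (γ ν : ℝ) (w : ℝ → ℝ)
    (χ : E3 → ℝ) : ℝ :=
  energy lam σ Ω Ae B χ + γ * mass lam Ω Ae χ + ν * enstrophy lam σ Ω Ae B w χ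

/-- `χ₀` is a critical point of the energy-Casimir functional: the first variation vanishes in the
direction of every variation that is `C²` up to the boundary and zero on the boundary. -/
def IsCritical (lam σ : ℝ) (Ω : Set E3) (Ae : E3 → ℝ) (B : E3 → E3) (γ ν : ℝ) (w : ℝ → ℝ)
    (χ₀ : E3 → ℝ) : Prop :=
  ∀ h : E3 → ℝ, ContDiffUpTo 2 h Ω → (∀ x ∈ frontier Ω, h x = 0) →
    HasDerivAt (fun s : ℝ => energyCasimir lam σ Ω Ae B γ ν w (fun x => χ₀ x + s * h x)) 0 0

/-- The integrability condition `∇ × (A_e B / B²) = 0` in `Ω`. -/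
def Integrability (Ω : Set E3) (Ae : E3 → ℝ) (B : E3 → E3) : Prop :=
  ∀ x ∈ Ω, curl (fun y => (Ae y / ‖B y‖ ^ 2) • B y) x = 0

open Classical in
/-- The square of the norm `‖·‖_⊥`. -/
def normPerpSq (lam σ : ℝ) (Ω : Set E3) (Ae : E3 → ℝ) (B : E3 → E3) (χ : E3 → ℝ) : ℝ :=
  (∫ x in Ω, χ x ^ 2) + (∫ x in Ω, ‖gradPerp B χ x‖ ^ 2) +
    if Integrability Ω Ae B then ∫ x in Ω, opD lam σ Ae B χ x ^ 2 else 0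

end GHM

end

/-!
This is the energy-Casimir method. The fields of interest equal `-γ` on the boundary, and on them
`H[χ + γ] + ν W[χ]`, which differs from `H + γ M + ν W` by a constant, is conserved. Indeed the
flux of the GHM equation is tangent to the level sets of `χ`, which gives conservation of
`H[χ + γ]`. When `∇ × (A_e B / B²) = 0`, the field `A_e v_E` is moreover divergence free and carries
the potential vorticity `q = 𝒟χ / A_e`, which gives conservation of `W`. Subtracting from the
conserved quantity its value at the critical point `χ₀` leaves `H[χ - χ₀]` plus the integral of
`A_e` times the Bregman divergence of `ν w` between the two potential vorticities: the first-order
terms cancel by criticality. Since `ν w''` is bounded above and away from zero, this difference is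
comparable to `‖χ - χ₀‖_⊥²`.

The boundary of `Ω` may be arbitrarily rough. Boundary terms are removed by cutting off with
functions of `χ + γ` itself, using that its gradient vanishes almost everywhere on its zero set.
-/

noncomputable section

namespace GHM

open Filter Topology

/-! ### Vector calculus in `ℝ³` -/

theorem inner_eq_sum (u v : E3) : inner ℝ u v = u 0 * v 0 + u 1 * v 1 + u 2 * v 2 := by
  simp [PiLp.inner_apply, Fin.sum_univ_three, mul_comm]

theorem ext_three {u v : E3} (h0 : u 0 = v 0) (h1 : u 1 = v 1) (h2 : u 2 = v 2) : u = v := by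
  ext i
  fin_cases i
  · exact h0
  · exact h1
  · exact h2

@[simp] theorem cross_apply_zero (u v : E3) : cross u v 0 = u 1 * v 2 - u 2 * v 1 := by
  simp [cross, cross_apply]

@[simp] theorem cross_apply_one (u v : E3) : cross u v 1 = u 2 * v 0 - u 0 * v 2 := by
  simp [cross, cross_apply]

@[simp] theorem cross_apply_two (u v : E3) : cross u v 2 = u 0 * v 1 - u 1 * v 0 := by
  simp [cross, cross_apply]

theorem inner_cross_self_right (u v : E3) : inner ℝ v (cross u v) = 0 := by
  rw [inner_eq_sum, cross_apply_zero, cross_apply_one, cross_apply_two]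
  ring

theorem inner_cross_self_left (u v : E3) : inner ℝ u (cross u v) = 0 := by
  rw [inner_eq_sum, cross_apply_zero, cross_apply_one, cross_apply_two]
  ring

theorem cross_smul_left (c : ℝ) (u v : E3) : cross (c • u) v = c • cross u v := by
  simp [cross]

theorem cross_smul_right (c : ℝ) (u v : E3) : cross u (c • v) = c • cross u v := by
  simp [cross]

theorem cross_add_right (u v w : E3) : cross u (v + w) = cross u v + cross u w := by
  simp [cross]

@[simp] theorem cross_zero_right (u : E3) : cross u 0 = 0 := by
  simp [cross]

theorem contDiff_cross {n : WithTop ℕ∞} : ContDiff ℝ n (fun p : E3 × E3 => cross p.1 p.2) := by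
  have hfst : ∀ j : Fin 3, ContDiff ℝ n (fun p : E3 × E3 => p.1 j) :=
    contDiff_euclidean.1 contDiff_fst
  have hsnd : ∀ j : Fin 3, ContDiff ℝ n (fun p : E3 × E3 => p.2 j) :=
    contDiff_euclidean.1 contDiff_snd
  refine contDiff_euclidean.2 fun i => ?_
  fin_cases i
  · simpa using ((hfst 1).mul (hsnd 2)).sub ((hfst 2).mul (hsnd 1))
  · simpa using ((hfst 2).mul (hsnd 0)).sub ((hfst 0).mul (hsnd 2))
  · simpa using ((hfst 0).mul (hsnd 1)).sub ((hfst 1).mul (hsnd 0))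

theorem pd_eq_fderiv_coord {F : E3 → E3} {x : E3} (hF : DifferentiableAt ℝ F x) (i j : Fin 3) :
    pd F i j x = fderiv ℝ (fun y => F y j) x (EuclideanSpace.single i 1) := by
  have hcoord : HasFDerivAt (fun y => F y j)
      ((EuclideanSpace.proj (𝕜 := ℝ) j : E3 →L[ℝ] ℝ).comp (fderiv ℝ F x)) x :=
    (EuclideanSpace.proj (𝕜 := ℝ) j : E3 →L[ℝ] ℝ).hasFDerivAt.comp x hF.hasFDerivAt
  rw [hcoord.fderiv]
  rfl

theorem dive_eq_of_hasFDerivAt {F : E3 → E3} {x : E3} {F' : E3 →L[ℝ] E3}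
    (h : HasFDerivAt F F' x) : dive F x = ∑ i, F' (EuclideanSpace.single i 1) i := by
  simp only [dive, pd, h.fderiv]

theorem dive_congr {F G : E3 → E3} {x : E3} (h : F =ᶠ[𝓝 x] G) : dive F x = dive G x := by
  simp only [dive, pd, h.fderiv_eq]

theorem clm_apply_eq_sum (L : E3 →L[ℝ] ℝ) (v : E3) :
    L v = ∑ i, v i * L (EuclideanSpace.single i 1) := by
  conv_lhs => rw [← (EuclideanSpace.basisFun (Fin 3) ℝ).sum_repr v]
  simp

theorem dive_smul {ψ : E3 → ℝ} {F : E3 → E3} {x : E3} (hψ : DifferentiableAt ℝ ψ x)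
    (hF : DifferentiableAt ℝ F x) :
    dive (fun y => ψ y • F y) x = ψ x * dive F x + fderiv ℝ ψ x (F x) := by
  rw [dive_eq_of_hasFDerivAt (hψ.hasFDerivAt.fun_smul hF.hasFDerivAt),
    dive_eq_of_hasFDerivAt hF.hasFDerivAt, clm_apply_eq_sum (fderiv ℝ ψ x), Finset.mul_sum,
    ← Finset.sum_add_distrib]
  simp [mul_comm]

theorem dive_add {F G : E3 → E3} {x : E3} (hF : DifferentiableAt ℝ F x)
    (hG : DifferentiableAt ℝ G x) : dive (fun y => F y + G y) x = dive F x + dive G x := by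
  rw [dive_eq_of_hasFDerivAt (hF.hasFDerivAt.fun_add hG.hasFDerivAt),
    dive_eq_of_hasFDerivAt hF.hasFDerivAt, dive_eq_of_hasFDerivAt hG.hasFDerivAt,
    ← Finset.sum_add_distrib]
  rfl

theorem dive_const_smul (c : ℝ) {F : E3 → E3} {x : E3} (hF : DifferentiableAt ℝ F x) :
    dive (fun y => c • F y) x = c * dive F x := by
  simp [dive_smul (differentiableAt_const c) hF]

theorem dive_cross {F G : E3 → E3} {x : E3} (hF : DifferentiableAt ℝ F x)
    (hG : DifferentiableAt ℝ G x) :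
    dive (fun y => cross (F y) (G y)) x =
      inner ℝ (G x) (curl F x) - inner ℝ (F x) (curl G x) := by
  have hcross : DifferentiableAt ℝ (fun y => cross (F y) (G y)) x :=
    ((contDiff_cross (n := 1)).differentiable one_ne_zero).differentiableAt.comp x (hF.prodMk hG)
  have hFc := differentiableAt_euclidean.1 hF
  have hGc := differentiableAt_euclidean.1 hG
  have hminor : ∀ a b c d i : Fin 3,
      fderiv ℝ (fun y => F y a * G y b - F y c * G y d) x (EuclideanSpace.single i 1) =
        F x a * pd G i b x + G x b * pd F i a x - (F x c * pd G i d x + G x d * pd F i c x) := by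
    intro a b c d i
    rw [pd_eq_fderiv_coord hF, pd_eq_fderiv_coord hF, pd_eq_fderiv_coord hG, pd_eq_fderiv_coord hG,
      (((hFc a).hasFDerivAt.fun_mul (hGc b).hasFDerivAt).fun_sub
        ((hFc c).hasFDerivAt.fun_mul (hGc d).hasFDerivAt)).fderiv]
    simp
  simp only [dive, Fin.sum_univ_three, pd_eq_fderiv_coord hcross, cross_apply_zero,
    cross_apply_one, cross_apply_two, hminor, inner_eq_sum, curl,
    Matrix.cons_val_zero, Matrix.cons_val_one, Matrix.cons_val]
  ring

theorem fderiv_apply_eq_inner_gradient (χ : E3 → ℝ) (x v : E3) :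
    fderiv ℝ χ x v = inner ℝ (gradient χ x) v := by
  simp [gradient]

theorem gradient_apply (χ : E3 → ℝ) (x : E3) (j : Fin 3) :
    gradient χ x j = fderiv ℝ χ x (EuclideanSpace.single j 1) := by
  rw [fderiv_apply_eq_inner_gradient, EuclideanSpace.inner_single_right]
  simp

theorem curl_gradient {χ : E3 → ℝ} {x : E3} (h : ContDiffAt ℝ 2 χ x) :
    curl (gradient χ) x = 0 := by
  have hfderiv : DifferentiableAt ℝ (fderiv ℝ χ) x :=
    (h.fderiv_right (m := 1) (by norm_num)).differentiableAt one_ne_zero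
  have hgrad : DifferentiableAt ℝ (gradient χ) x :=
    ((InnerProductSpace.toDual ℝ E3).symm.toContinuousLinearEquiv.differentiableAt).comp x hfderiv
  have hpd : ∀ i j, pd (gradient χ) i j x =
      fderiv ℝ (fderiv ℝ χ) x (EuclideanSpace.single i 1) (EuclideanSpace.single j 1) := by
    intro i j
    rw [pd_eq_fderiv_coord hgrad]
    simp only [gradient_apply]
    rw [(hfderiv.hasFDerivAt.clm_apply
      (hasFDerivAt_const (EuclideanSpace.single j (1 : ℝ)) x)).fderiv]
    simp
  have hsymm : ∀ i j, pd (gradient χ) i j x - pd (gradient χ) j i x = 0 := fun i j => by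
    rw [hpd, hpd, sub_eq_zero]
    exact h.isSymmSndFDerivAt (by simp) _ _
  exact ext_three (hsymm 1 2) (hsymm 2 0) (hsymm 0 1)

section SMulOfEqZero

variable {X Y : Type*} [NormedAddCommGroup X] [NormedSpace ℝ X] [NormedAddCommGroup Y]
  [NormedSpace ℝ Y]

theorem hasFDerivAt_smul_of_eq_zero {c : X → ℝ} {V : X → Y} {V' : X →L[ℝ] Y} {x : X}
    (hc : ContinuousAt c x) (hV : HasFDerivAt V V' x) (h0 : V x = 0) :
    HasFDerivAt (fun y => c y • V y) (c x • V') x := by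
  have hosc : (fun y => c y - c x) =o[𝓝 x] fun _ => (1 : ℝ) := by
    rw [Asymptotics.isLittleO_one_iff]
    simpa using hc.tendsto.sub_const (c x)
  have hVO : V =O[𝓝 x] fun y => y - x := by simpa [h0] using hV.isBigO_sub
  have hsmul : (fun y => (c y - c x) • V y) =o[𝓝 x] fun y => y - x := by
    simpa using hosc.smul_isBigO hVO
  refine .of_isLittleO ((hsmul.add (hV.isLittleO.const_smul_left (c x))).congr_left fun y => ?_)
  change (c y - c x) • V y + c x • (V y - V x - V' (y - x)) =
    c y • V y - c x • V x - c x • V' (y - x)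
  rw [h0]
  module

theorem differentiableAt_of_differentiableAt_smul {q : X → ℝ} {V : X → Y} {x : X}
    (hV : DifferentiableAt ℝ V x) (hqV : DifferentiableAt ℝ (fun y => q y • V y) x)
    (h0 : V x ≠ 0) : DifferentiableAt ℝ q x := by
  obtain ⟨ℓ, hℓ⟩ := SeparatingDual.exists_ne_zero (R := ℝ) h0
  have hℓV : DifferentiableAt ℝ (fun y => ℓ (V y)) x := ℓ.differentiableAt.comp x hV
  have hℓqV : DifferentiableAt ℝ (fun y => ℓ (q y • V y)) x := ℓ.differentiableAt.comp x hqV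
  have hquot : DifferentiableAt ℝ (fun y => ℓ (q y • V y) * (ℓ (V y))⁻¹) x :=
    hℓqV.fun_mul (hℓV.fun_inv hℓ)
  refine hquot.congr_of_eventuallyEq ?_
  filter_upwards [hℓV.continuousAt.eventually_ne hℓ] with y hy
  rw [map_smul, smul_eq_mul, mul_inv_cancel_right₀ hy]

end SMulOfEqZero

theorem dive_smul_of_eq_zero {c : E3 → ℝ} {V : E3 → E3} {x : E3} (hc : ContinuousAt c x)
    (hV : DifferentiableAt ℝ V x) (h0 : V x = 0) :
    dive (fun y => c y • V y) x = c x * dive V x := by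
  rw [dive_eq_of_hasFDerivAt (hasFDerivAt_smul_of_eq_zero hc hV.hasFDerivAt h0),
    dive_eq_of_hasFDerivAt hV.hasFDerivAt, Finset.mul_sum]
  rfl

section DivergenceFree

variable {q : E3 → ℝ} {V : E3 → E3} {f : ℝ → ℝ} {x : E3}

theorem differentiableAt_comp_smul (hq : ContinuousAt q x) (hV : DifferentiableAt ℝ V x)
    (hqV : DifferentiableAt ℝ (fun y => q y • V y) x) (hf : DifferentiableAt ℝ f (q x)) :
    DifferentiableAt ℝ (fun y => f (q y) • V y) x := by
  by_cases h0 : V x = 0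
  · exact (hasFDerivAt_smul_of_eq_zero (hf.continuousAt.comp' hq)
      hV.hasFDerivAt h0).differentiableAt
  · exact (hf.comp x (differentiableAt_of_differentiableAt_smul hV hqV h0)).smul hV

-- Only `q V`, not `q`, is differentiable: where `V ≠ 0` this recovers the differentiability of `q`,
-- and where `V = 0` both sides vanish.
theorem dive_comp_smul (hq : ContinuousAt q x) (hV : DifferentiableAt ℝ V x)
    (hqV : DifferentiableAt ℝ (fun y => q y • V y) x) (hf : DifferentiableAt ℝ f (q x))
    (hdiv : dive V x = 0) :
    dive (fun y => f (q y) • V y) x = deriv f (q x) * dive (fun y => q y • V y) x := by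
  by_cases h0 : V x = 0
  · rw [dive_smul_of_eq_zero (c := fun y => f (q y)) (hf.continuousAt.comp' hq) hV h0,
      dive_smul_of_eq_zero hq hV h0, hdiv, mul_zero, mul_zero, mul_zero]
  · have hqd := differentiableAt_of_differentiableAt_smul hV hqV h0
    have hfq : HasFDerivAt (fun y => f (q y)) (deriv f (q x) • fderiv ℝ q x) x :=
      hf.hasDerivAt.comp_hasFDerivAt x hqd.hasFDerivAt
    simp [dive_smul hfq.differentiableAt hV, dive_smul hqd hV, hdiv, hfq.fderiv]

end DivergenceFree

/-! ### Bounded continuous and bounded `C¹` functions on a set -/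

/-- `f` is continuous and bounded on `s`. On a set of finite measure this is the integrability
class of all the integrands below. -/
structure BddContOn {X Y : Type*} [TopologicalSpace X] [NormedAddCommGroup Y] (f : X → Y)
    (s : Set X) : Prop where
  continuousOn : ContinuousOn f s
  exists_bound : ∃ C, ∀ x ∈ s, ‖f x‖ ≤ C

namespace BddContOn

variable {X Y Z : Type*} [TopologicalSpace X] [NormedAddCommGroup Y] [NormedAddCommGroup Z]
  {s : Set X}

theorem of_continuousOn_closure {f : X → Y} (hf : ContinuousOn f (closure s))
    (hs : IsCompact (closure s)) : BddContOn f s := by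
  obtain ⟨C, hC⟩ := hs.exists_bound_of_continuousOn hf
  exact ⟨hf.mono subset_closure, C, fun x hx => hC x (subset_closure hx)⟩

theorem congr {f g : X → Y} (hf : BddContOn f s) (h : EqOn g f s) : BddContOn g s := by
  obtain ⟨C, hC⟩ := hf.exists_bound
  exact ⟨hf.continuousOn.congr h, C, fun x hx => (h hx).symm ▸ hC x hx⟩

theorem prodMk {f : X → Y} {g : X → Z} (hf : BddContOn f s) (hg : BddContOn g s) :
    BddContOn (fun x => (f x, g x)) s := by
  obtain ⟨C, hC⟩ := hf.exists_bound
  obtain ⟨D, hD⟩ := hg.exists_bound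
  exact ⟨hf.continuousOn.prodMk hg.continuousOn, max C D, fun x hx =>
    max_le_max (hC x hx) (hD x hx)⟩

theorem comp [ProperSpace Y] {f : X → Y} (hf : BddContOn f s) {φ : Y → Z} (hφ : Continuous φ) :
    BddContOn (fun x => φ (f x)) s := by
  obtain ⟨C, hC⟩ := hf.exists_bound
  obtain ⟨D, hD⟩ :=
    (isCompact_closedBall (0 : Y) C).exists_bound_of_continuousOn hφ.continuousOn
  exact ⟨hφ.comp_continuousOn hf.continuousOn, D, fun x hx =>
    hD _ (mem_closedBall_zero_iff.2 (hC x hx))⟩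

theorem inner [InnerProductSpace ℝ Y] [ProperSpace Y] {f g : X → Y} (hf : BddContOn f s)
    (hg : BddContOn g s) : BddContOn (fun x => Inner.inner ℝ (f x) (g x)) s :=
  (hf.prodMk hg).comp (φ := fun p : Y × Y => Inner.inner ℝ p.1 p.2) continuous_inner

theorem const (c : Y) : BddContOn (fun _ : X => c) s :=
  ⟨continuousOn_const, ‖c‖, fun _ _ => le_rfl⟩

variable {f g : X → ℝ}

theorem add (hf : BddContOn f s) (hg : BddContOn g s) : BddContOn (fun x => f x + g x) s :=
  (hf.prodMk hg).comp continuous_add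

theorem sub (hf : BddContOn f s) (hg : BddContOn g s) : BddContOn (fun x => f x - g x) s :=
  (hf.prodMk hg).comp continuous_sub

theorem mul (hf : BddContOn f s) (hg : BddContOn g s) : BddContOn (fun x => f x * g x) s :=
  (hf.prodMk hg).comp continuous_mul

theorem const_mul (c : ℝ) (hf : BddContOn f s) : BddContOn (fun x => c * f x) s :=
  hf.comp (continuous_const_mul c)

theorem neg (hf : BddContOn f s) : BddContOn (fun x => -f x) s :=
  hf.comp continuous_neg

theorem integrableOn [MeasurableSpace X] [OpensMeasurableSpace X] {μ : Measure X}
    (hf : BddContOn f s) (hs : MeasurableSet s) (hμ : μ s ≠ ⊤) : IntegrableOn f s μ := by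
  obtain ⟨C, hC⟩ := hf.exists_bound
  exact .of_bound hμ.lt_top (hf.continuousOn.aestronglyMeasurable hs) C
    (ae_restrict_of_forall_mem hs hC)

end BddContOn

/-- `f` is differentiable at the points of `s`, and both `f` and its derivative are continuous and
bounded on `s`. -/
structure BddC1On {X Y : Type*} [NormedAddCommGroup X] [NormedSpace ℝ X] [NormedAddCommGroup Y]
    [NormedSpace ℝ Y] (f : X → Y) (s : Set X) : Prop where
  differentiableAt : ∀ x ∈ s, DifferentiableAt ℝ f x
  bddContOn : BddContOn f s
  bddContOn_fderiv : BddContOn (fderiv ℝ f) s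

namespace BddC1On

variable {X Y Z : Type*} [NormedAddCommGroup X] [NormedSpace ℝ X] [NormedAddCommGroup Y]
  [NormedSpace ℝ Y] [NormedAddCommGroup Z] [NormedSpace ℝ Z] {s : Set X}

theorem differentiableOn {f : X → Y} (hf : BddC1On f s) : DifferentiableOn ℝ f s :=
  fun x hx => (hf.differentiableAt x hx).differentiableWithinAt

theorem prodMk {f : X → Y} {g : X → Z} (hf : BddC1On f s) (hg : BddC1On g s) :
    BddC1On (fun x => (f x, g x)) s := by
  have hfderiv : EqOn (fderiv ℝ fun x => (f x, g x))
      (fun x => (fderiv ℝ f x).prod (fderiv ℝ g x)) s := fun x hx =>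
    ((hf.differentiableAt x hx).hasFDerivAt.prodMk (hg.differentiableAt x hx).hasFDerivAt).fderiv
  obtain ⟨C, hC⟩ := hf.bddContOn_fderiv.exists_bound
  obtain ⟨D, hD⟩ := hg.bddContOn_fderiv.exists_bound
  refine ⟨fun x hx => (hf.differentiableAt x hx).prodMk (hg.differentiableAt x hx),
    hf.bddContOn.prodMk hg.bddContOn, .congr ⟨?_, max C D, fun x hx => ?_⟩ hfderiv⟩
  · exact (ContinuousLinearMap.prodₗᵢ ℝ).continuous.comp_continuousOn
      (hf.bddContOn_fderiv.continuousOn.prodMk hg.bddContOn_fderiv.continuousOn)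
  · rw [ContinuousLinearMap.opNorm_prod]
    exact max_le_max (hC x hx) (hD x hx)

theorem comp {f : X → Y} (hf : BddC1On f s) {O K : Set Y} (hO : IsOpen O) (hK : IsCompact K)
    (hKO : K ⊆ O) (hfK : MapsTo f s K) {Ψ : Y → Z} (hΨ : ContDiffOn ℝ 1 Ψ O) :
    BddC1On (fun x => Ψ (f x)) s := by
  have hΨd : ∀ y ∈ K, DifferentiableAt ℝ Ψ y := fun y hy =>
    (hΨ.differentiableOn one_ne_zero).differentiableAt (hO.mem_nhds (hKO hy))
  have hΨc : ContinuousOn (fderiv ℝ Ψ) K :=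
    (hΨ.continuousOn_fderiv_of_isOpen hO le_rfl).mono hKO
  have hfderiv : EqOn (fderiv ℝ fun x => Ψ (f x))
      (fun x => (fderiv ℝ Ψ (f x)).comp (fderiv ℝ f x)) s := fun x hx =>
    fderiv_comp x (hΨd _ (hfK hx)) (hf.differentiableAt x hx)
  have hfc := hf.bddContOn.continuousOn
  obtain ⟨C, hC⟩ := hf.bddContOn_fderiv.exists_bound
  obtain ⟨D, hD⟩ := hK.exists_bound_of_continuousOn (hΨ.continuousOn.mono hKO)
  obtain ⟨M, hM⟩ := hK.exists_bound_of_continuousOn hΨc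
  refine ⟨fun x hx => (hΨd _ (hfK hx)).comp x (hf.differentiableAt x hx),
    ⟨(hΨ.continuousOn.mono hKO).comp hfc hfK, D, fun x hx => hD _ (hfK hx)⟩,
    .congr ⟨(hΨc.comp hfc hfK).clm_comp hf.bddContOn_fderiv.continuousOn, M * C, fun x hx => ?_⟩
      hfderiv⟩
  exact (ContinuousLinearMap.opNorm_comp_le _ _).trans
    (mul_le_mul (hM _ (hfK hx)) (hC x hx) (norm_nonneg _) ((norm_nonneg _).trans (hM _ (hfK hx))))

theorem comp_contDiff [ProperSpace Y] {f : X → Y} (hf : BddC1On f s) {Ψ : Y → Z}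
    (hΨ : ContDiff ℝ 1 Ψ) : BddC1On (fun x => Ψ (f x)) s := by
  obtain ⟨C, hC⟩ := hf.bddContOn.exists_bound
  exact hf.comp isOpen_univ (isCompact_closedBall (0 : Y) C) (subset_univ _)
    (fun x hx => mem_closedBall_zero_iff.2 (hC x hx)) hΨ.contDiffOn

theorem mul {f g : X → ℝ} (hf : BddC1On f s) (hg : BddC1On g s) :
    BddC1On (fun x => f x * g x) s :=
  (hf.prodMk hg).comp_contDiff contDiff_mul

theorem smul [ProperSpace Y] {f : X → ℝ} {g : X → Y} (hf : BddC1On f s) (hg : BddC1On g s) :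
    BddC1On (fun x => f x • g x) s :=
  (hf.prodMk hg).comp_contDiff contDiff_smul

theorem cross {F G : X → E3} (hF : BddC1On F s) (hG : BddC1On G s) :
    BddC1On (fun x => cross (F x) (G x)) s :=
  (hF.prodMk hG).comp_contDiff contDiff_cross

theorem bddContOn_dive {Ω : Set E3} {F : E3 → E3} (hF : BddC1On F Ω) : BddContOn (dive F) Ω :=
  hF.bddContOn_fderiv.comp (φ := fun L => ∑ i, L (EuclideanSpace.single i 1) i) (by fun_prop)

end BddC1On

/-! ### Functions of class `Cⁿ` up to the boundary -/

namespace ContDiffUpTo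

variable {X Y Z : Type*} [NormedAddCommGroup X] [NormedSpace ℝ X] [NormedAddCommGroup Y]
  [NormedSpace ℝ Y] [NormedAddCommGroup Z] [NormedSpace ℝ Z] {n : ℕ} {s : Set X}

theorem contDiffOn {f : X → Y} (h : ContDiffUpTo n f s) : ContDiffOn ℝ n f s :=
  let ⟨_, _, hp, _⟩ := h
  HasFTaylorSeriesUpToOn.contDiffOn (n := n) hp

theorem clm_comp {f : X → Y} (h : ContDiffUpTo n f s) (L : Y →L[ℝ] Z) :
    ContDiffUpTo n (fun x => L (f x)) s := by
  obtain ⟨hc, p, hp, hpc⟩ := h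
  exact ⟨L.continuous.comp_continuousOn hc, _, hp.continuousLinearMap_comp L, fun m hm =>
    (ContinuousLinearMap.compContinuousMultilinearMapL ℝ (fun _ : Fin m => X) Y Z
      L).continuous.comp_continuousOn (hpc m hm)⟩

theorem prodMk {f : X → Y} {g : X → Z} (hf : ContDiffUpTo n f s) (hg : ContDiffUpTo n g s) :
    ContDiffUpTo n (fun x => (f x, g x)) s := by
  obtain ⟨hfc, p, hp, hpc⟩ := hf
  obtain ⟨hgc, q, hq, hqc⟩ := hg
  exact ⟨hfc.prodMk hgc, _, hp.prodMk hq, fun m hm =>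
    (ContinuousMultilinearMap.prodL ℝ (fun _ : Fin m => X) Y Z).continuous.comp_continuousOn
      ((hpc m hm).prodMk (hqc m hm))⟩

theorem add {f g : X → Y} (hf : ContDiffUpTo n f s) (hg : ContDiffUpTo n g s) :
    ContDiffUpTo n (fun x => f x + g x) s :=
  (hf.prodMk hg).clm_comp (ContinuousLinearMap.fst ℝ Y Y + ContinuousLinearMap.snd ℝ Y Y)

theorem sub {f g : X → Y} (hf : ContDiffUpTo n f s) (hg : ContDiffUpTo n g s) :
    ContDiffUpTo n (fun x => f x - g x) s :=
  (hf.prodMk hg).clm_comp (ContinuousLinearMap.fst ℝ Y Y - ContinuousLinearMap.snd ℝ Y Y)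

theorem of_contDiff {f : X → Y} (hf : ContDiff ℝ n f) : ContDiffUpTo n f s :=
  ⟨hf.continuous.continuousOn, ftaylorSeries ℝ f,
    (hasFTaylorSeriesUpToOn_univ_iff.2 hf.ftaylorSeries).mono (subset_univ s),
    fun m hm => (hf.continuous_iteratedFDeriv (m := m) (mod_cast hm)).continuousOn⟩

theorem add_const {f : X → Y} (hf : ContDiffUpTo n f s) (c : Y) :
    ContDiffUpTo n (fun x => f x + c) s :=
  hf.add (of_contDiff contDiff_const)

theorem const_mul (c : ℝ) {f : X → ℝ} (hf : ContDiffUpTo n f s) :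
    ContDiffUpTo n (fun x => c * f x) s :=
  hf.clm_comp (c • ContinuousLinearMap.id ℝ ℝ)

theorem slice {T : Set ℝ} {χ : ℝ → X → Y} (h : ContDiffUpTo n (Function.uncurry χ) (T ×ˢ s))
    {t : ℝ} (ht : t ∈ T) : ContDiffUpTo n (χ t) s := by
  obtain ⟨hc, p, hp, hpc⟩ := h
  let ι : X →ᴬ[ℝ] ℝ × X := .const ℝ X (t, 0) + (ContinuousLinearMap.inr ℝ ℝ X).toContinuousAffineMap
  have hι : ∀ x, ι x = (t, x) := fun x => by simp [ι]
  have hιs : s ⊆ ι ⁻¹' (T ×ˢ s) := fun x hx => by simp [hι, ht, hx]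
  have hιc : MapsTo ι (closure s) (closure (T ×ˢ s)) := fun x hx => by
    rw [hι, closure_prod_eq]
    exact ⟨subset_closure ht, hx⟩
  have hcomp : χ t = Function.uncurry χ ∘ ι := by ext x; simp [hι]
  rw [hcomp]
  exact ⟨hc.comp ι.continuous.continuousOn hιc, _, (hp.comp_continuousAffineMap ι).mono hιs,
    fun m hm => (isBoundedLinearMap_continuousMultilinearMap_comp_linear (ι := Fin m)
      ι.contLinear).continuous.comp_continuousOn ((hpc m hm).comp ι.continuous.continuousOn hιc)⟩

theorem tendsto_nhdsWithin_frontier {f : X → Y} (h : ContDiffUpTo n f s)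
    (h0 : ∀ x ∈ frontier s, f x = 0) : ∀ x ∈ frontier s, Tendsto f (𝓝[s] x) (𝓝 0) := fun x hx =>
  h0 x hx ▸ (h.1 x (frontier_subset_closure hx)).tendsto.mono_left
    (nhdsWithin_mono x subset_closure)

theorem exists_iteratedFDeriv_bound {f : X → Y} (h : ContDiffUpTo n f s) (hs : IsOpen s)
    (hsc : IsCompact (closure s)) {m : ℕ} (hm : m ≤ n) :
    ∃ C, ∀ x ∈ s, ‖iteratedFDeriv ℝ m f x‖ ≤ C := by
  obtain ⟨_, p, hp, hpc⟩ := h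
  obtain ⟨C, hC⟩ := hsc.exists_bound_of_continuousOn (hpc m hm)
  refine ⟨C, fun x hx => ?_⟩
  rw [← iteratedFDerivWithin_of_isOpen m hs hx,
    ← hp.eq_iteratedFDerivWithin_of_uniqueDiffOn (mod_cast hm) hs.uniqueDiffOn hx]
  exact hC x (subset_closure hx)

theorem bddC1On {f : X → Y} (h : ContDiffUpTo n f s) (hn : 1 ≤ n) (hs : IsOpen s)
    (hsc : IsCompact (closure s)) : BddC1On f s := by
  have hf : ContDiffOn ℝ 1 f s := h.contDiffOn.of_le (mod_cast hn)
  obtain ⟨C, hC⟩ := h.exists_iteratedFDeriv_bound hs hsc hn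
  simp only [norm_iteratedFDeriv_one] at hC
  exact ⟨fun x hx => (hf.differentiableOn one_ne_zero).differentiableAt (hs.mem_nhds hx),
    .of_continuousOn_closure h.1 hsc, hf.continuousOn_fderiv_of_isOpen hs le_rfl, C, hC⟩

theorem bddC1On_fderiv {f : X → Y} (h : ContDiffUpTo n f s) (hn : 2 ≤ n) (hs : IsOpen s)
    (hsc : IsCompact (closure s)) : BddC1On (fderiv ℝ f) s := by
  have hf : ContDiffOn ℝ 1 (fderiv ℝ f) s :=
    (h.contDiffOn.of_le (mod_cast hn)).fderiv_of_isOpen hs one_add_one_eq_two.le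
  obtain ⟨C, hC⟩ := h.exists_iteratedFDeriv_bound hs hsc hn
  simp only [← norm_iteratedFDeriv_fderiv, norm_iteratedFDeriv_zero] at hC
  exact ⟨fun x hx => (hf.differentiableOn one_ne_zero).differentiableAt (hs.mem_nhds hx),
    (h.bddC1On (one_le_two.trans hn) hs hsc).bddContOn_fderiv,
    hf.continuousOn_fderiv_of_isOpen hs le_rfl, C, hC⟩

theorem bddC1On_gradient {Ω : Set E3} {χ : E3 → ℝ} (h : ContDiffUpTo n χ Ω) (hn : 2 ≤ n)
    (hΩ : IsOpen Ω) (hΩc : IsCompact (closure Ω)) : BddC1On (gradient χ) Ω :=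
  (h.bddC1On_fderiv hn hΩ hΩc).comp_contDiff
    (InnerProductSpace.toDual ℝ E3).symm.toContinuousLinearEquiv.contDiff

end ContDiffUpTo

/-! ### The divergence theorem and integration by parts on an arbitrary bounded open set -/

theorem integral_sum_fderiv_single_eq_zero {n : ℕ} {f : (Fin (n + 1) → ℝ) → Fin (n + 1) → ℝ}
    (hf : Differentiable ℝ f) (hsupp : HasCompactSupport f)
    (hint : Integrable fun x => ∑ i, fderiv ℝ f x (Pi.single i 1) i) :
    ∫ x, ∑ i, fderiv ℝ f x (Pi.single i 1) i = 0 := by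
  obtain ⟨r, hr, hsub⟩ := hsupp.isCompact.isBounded.subset_ball_lt 0 0
  have hout : ∀ (x : Fin (n + 1) → ℝ) i, r ≤ |x i| → x ∉ tsupport f := fun x i hxi hx =>
    (hxi.trans (norm_le_pi_norm x i)).not_gt (mem_ball_zero_iff.1 (hsub hx))
  have hface : ∀ i c (z : Fin n → ℝ), r ≤ |c| →
      f (i.insertNth (α := fun _ => ℝ) c z) i = 0 := fun i c z hc =>
    congrFun (image_eq_zero_of_notMem_tsupport (hout _ i (by simpa using hc))) i
  have hbox := integral_divergence_of_hasFDerivAt_off_countable (fun _ => -r) (fun _ => r)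
    (fun _ => (neg_lt_self hr).le) f (fderiv ℝ f) ∅ countable_empty hf.continuous.continuousOn
    (fun x _ => (hf x).hasFDerivAt) hint.integrableOn
  rw [setIntegral_eq_integral_of_forall_compl_eq_zero] at hbox
  · rw [hbox]
    refine Finset.sum_eq_zero fun i _ => ?_
    simp only [hface i r _ (le_abs_self r), hface i (-r) _ (abs_neg r ▸ le_abs_self r), sub_self]
  · intro x hx
    obtain ⟨i, hi⟩ : ∃ i, r ≤ |x i| := by
      by_contra! hlt
      exact hx ⟨fun i => (abs_lt.1 (hlt i)).1.le, fun i => (abs_lt.1 (hlt i)).2.le⟩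
    rw [image_eq_zero_of_notMem_tsupport fun h => hout x i hi (tsupport_fderiv_subset ℝ h)]
    simp

theorem integral_dive_eq_zero {G : E3 → E3} (hG : Differentiable ℝ G) (hsupp : HasCompactSupport G)
    (hint : Integrable (dive G)) : ∫ x, dive G x = 0 := by
  let e := EuclideanSpace.equiv (Fin 3) ℝ
  have hvol := PiLp.volume_preserving_toLp (Fin 3)
  have hemb := (MeasurableEquiv.toLp 2 (Fin 3 → ℝ)).measurableEmbedding
  have hf : ∀ y, HasFDerivAt (fun y => e (G (e.symm y))) ((e : E3 →L[ℝ] Fin 3 → ℝ).comp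
      ((fderiv ℝ G (e.symm y)).comp (e.symm : (Fin 3 → ℝ) →L[ℝ] E3))) y := fun y =>
    e.hasFDerivAt.comp y ((hG (e.symm y)).hasFDerivAt.comp y e.symm.hasFDerivAt)
  have hdive : (fun y => ∑ i, fderiv ℝ (fun y => e (G (e.symm y))) y (Pi.single i 1) i) =
      fun y => dive G (WithLp.toLp 2 y) := by
    ext y
    rw [(hf y).fderiv]
    rfl
  have hsupp' : HasCompactSupport fun y => e (G (e.symm y)) :=
    (hsupp.comp_homeomorph e.symm.toHomeomorph).comp_left (map_zero e)
  rw [← hvol.integral_comp hemb, ← hdive]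
  refine integral_sum_fderiv_single_eq_zero (fun y => (hf y).differentiableAt) hsupp' ?_
  rw [hdive]
  exact (hvol.integrable_comp_emb hemb).2 hint

theorem setIntegral_dive_eq_zero {Ω : Set E3} (hΩo : IsOpen Ω) (hΩb : Bornology.IsBounded Ω)
    {G : E3 → E3} (hG : DifferentiableOn ℝ G Ω)
    (hG0 : ∀ x ∈ frontier Ω, ∀ᶠ y in 𝓝[Ω] x, G y = 0) (hint : IntegrableOn (dive G) Ω) :
    ∫ x in Ω, dive G x = 0 := by
  have hinside : ∀ x ∈ Ω, Ω.indicator G =ᶠ[𝓝 x] G := fun x hx => by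
    filter_upwards [hΩo.mem_nhds hx] with y hy using indicator_of_mem hy G
  have houtside : ∀ x ∉ Ω, Ω.indicator G =ᶠ[𝓝 x] fun _ => 0 := fun x hx => by
    have hev : ∀ᶠ y in 𝓝[Ω] x, G y = 0 := by
      by_cases hxc : x ∈ closure Ω
      · exact hG0 x ⟨hxc, by rwa [hΩo.interior_eq]⟩
      · simp [notMem_closure_iff_nhdsWithin_eq_bot.1 hxc]
    filter_upwards [eventually_nhdsWithin_iff.1 hev] with y hy
    exact indicator_apply_eq_zero.2 hy
  have hdive : dive (Ω.indicator G) = Ω.indicator (dive G) := by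
    ext x
    by_cases hx : x ∈ Ω
    · rw [indicator_of_mem hx, dive_congr (hinside x hx)]
    · rw [indicator_of_notMem hx, dive_congr (houtside x hx)]
      simp [dive, pd]
  have hdiff : Differentiable ℝ (Ω.indicator G) := fun x => by
    by_cases hx : x ∈ Ω
    · exact (hG.differentiableAt (hΩo.mem_nhds hx)).congr_of_eventuallyEq (hinside x hx)
    · exact (differentiableAt_const _).congr_of_eventuallyEq (houtside x hx)
  have hsupp : HasCompactSupport (Ω.indicator G) :=
    .intro hΩb.isCompact_closure fun x hx => indicator_of_notMem (notMem_of_notMem_closure hx) G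
  rw [← integral_indicator hΩo.measurableSet, ← hdive]
  refine integral_dive_eq_zero hdiff hsupp ?_
  rw [hdive]
  exact hint.integrable_indicator hΩo.measurableSet

theorem countable_setOf_eq_zero_and_deriv_ne_zero {F : Type*} [NormedAddCommGroup F]
    [NormedSpace ℝ F] (g : ℝ → F) : {s | g s = 0 ∧ deriv g s ≠ 0}.Countable := by
  refine (countable_setOfPred_isolated_right_within
    (s := {s | g s = 0 ∧ deriv g s ≠ 0})).mono ?_
  intro s hs
  refine ⟨hs, ?_⟩
  have hne : ∀ᶠ z in 𝓝[≠] s, g z ≠ 0 :=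
    (differentiableAt_of_deriv_ne_zero hs.2).hasDerivAt.eventually_ne hs.2
  rw [← empty_mem_iff_bot]
  filter_upwards [nhdsWithin_mono s (fun z hz => ne_of_gt hz.2) hne, self_mem_nhdsWithin]
    with z hz hzs using hz hzs.1.1

section AeFDeriv

variable {E F : Type*} [NormedAddCommGroup E] [NormedSpace ℝ E] [FiniteDimensional ℝ E]
  [MeasurableSpace E] [BorelSpace E] {μ : Measure E} [μ.IsAddHaarMeasure]
  [NormedAddCommGroup F] [NormedSpace ℝ F] [CompleteSpace F] [MeasurableSpace F] [BorelSpace F]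
  {u : E → F}

theorem ae_fderiv_apply_eq_zero_of_eq_zero (hu : Measurable u) (v : E) :
    ∀ᵐ x ∂μ, u x = 0 → fderiv ℝ u x v = 0 := by
  have hmeas : MeasurableSet {x | u x = 0 → fderiv ℝ u x v = 0} :=
    (hu (measurableSet_singleton 0)).imp
      (measurable_fderiv_apply_const ℝ u v (measurableSet_singleton 0))
  refine ae_mem_of_ae_add_linearMap_mem (LinearMap.toSpanSingleton ℝ E v) volume μ hmeas
    fun y => ?_
  filter_upwards [(countable_setOf_eq_zero_and_deriv_ne_zero fun s : ℝ => u (y + s • v)).ae_notMem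
    volume] with s hs hus
  by_contra hne
  have hd : DifferentiableAt ℝ u (y + s • v) := by
    by_contra hd
    exact hne (by simp [fderiv_zero_of_not_differentiableAt hd])
  have hline : HasDerivAt (fun s : ℝ => y + s • v) v s := by
    simpa using ((hasDerivAt_id s).smul_const v).const_add y
  exact hs ⟨hus, (hd.hasFDerivAt.comp_hasDerivAt s hline).deriv ▸ hne⟩

theorem ae_fderiv_eq_zero_of_eq_zero (hu : Measurable u) :
    ∀ᵐ x ∂μ, u x = 0 → fderiv ℝ u x = 0 := by
  let b := Module.finBasis ℝ E
  filter_upwards [ae_all_iff.2 fun i => ae_fderiv_apply_eq_zero_of_eq_zero (μ := μ) hu (b i)]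
    with x hx hux
  exact ContinuousLinearMap.coe_injective (b.ext fun i => hx i hux)

theorem ae_restrict_fderiv_eq_zero_of_eq_zero {s : Set E} (hs : IsOpen s)
    (hu : ContinuousOn u s) : ∀ᵐ x ∂μ.restrict s, u x = 0 → fderiv ℝ u x = 0 := by
  have hmeas : Measurable (s.indicator u) := by
    classical exact hu.measurable_piecewise continuousOn_const hs.measurableSet
  rw [ae_restrict_iff' hs.measurableSet]
  filter_upwards [ae_fderiv_eq_zero_of_eq_zero (μ := μ) hmeas] with x hx hxs hux
  have heq : s.indicator u =ᶠ[𝓝 x] u := by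
    filter_upwards [hs.mem_nhds hxs] with y hy using indicator_of_mem hy u
  rw [← heq.fderiv_eq]
  exact hx (by rw [indicator_of_mem hxs, hux])

end AeFDeriv

/-- The `C¹` cutoffs vanishing near `0` that converge pointwise to `1` away from `0`. -/
def cutoff (n : ℕ) (s : ℝ) : ℝ :=
  1 - (⟨1, 2, one_pos, one_lt_two⟩ : ContDiffBump (0 : ℝ)) ((n + 1) * s)

theorem contDiff_cutoff (n : ℕ) : ContDiff ℝ 1 (cutoff n) :=
  contDiff_const.sub ((ContDiffBump.contDiff _).comp (contDiff_const.mul contDiff_id))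

theorem abs_cutoff_le_one (n : ℕ) (s : ℝ) : |cutoff n s| ≤ 1 := by
  rw [cutoff, abs_of_nonneg (sub_nonneg.2 (ContDiffBump.le_one _))]
  exact sub_le_self _ (ContDiffBump.nonneg _)

theorem cutoff_eventuallyEq_zero (n : ℕ) : cutoff n =ᶠ[𝓝 0] 0 := by
  have hlim : Tendsto (fun s : ℝ => (n + 1) * s) (𝓝 0) (𝓝 0) := by
    simpa using (continuous_const_mul ((n : ℝ) + 1)).tendsto 0
  filter_upwards [hlim.eventually (ContDiffBump.eventuallyEq_one _)] with s hs
  rw [cutoff, hs, Pi.one_apply, Pi.zero_apply, sub_self]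

theorem eventually_cutoff_eventuallyEq_one {s : ℝ} (hs : s ≠ 0) :
    ∀ᶠ n in atTop, cutoff n =ᶠ[𝓝 s] 1 := by
  have hlim : Tendsto (fun n : ℕ => ((n : ℝ) + 1) * |s|) atTop atTop :=
    (tendsto_atTop_add_const_right _ _ tendsto_natCast_atTop_atTop).atTop_mul_const
      (abs_pos.2 hs)
  filter_upwards [hlim.eventually_gt_atTop 2] with n hn
  have hcont : Continuous fun y : ℝ => ((n : ℝ) + 1) * |y| := by fun_prop
  filter_upwards [(hcont.tendsto s).eventually_const_lt hn] with y hy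
  rw [cutoff, ContDiffBump.zero_of_le_dist, sub_zero, Pi.one_apply]
  rw [dist_zero_right, norm_mul, Real.norm_of_nonneg (by positivity), Real.norm_eq_abs]
  exact hy.le

theorem exists_abs_deriv_cutoff_mul_le : ∃ M, ∀ n s, |deriv (cutoff n) s * s| ≤ M := by
  let f : ContDiffBump (0 : ℝ) := ⟨1, 2, one_pos, one_lt_two⟩
  have hderiv : ∀ n s, deriv (cutoff n) s = -((n + 1) * deriv f ((n + 1) * s)) := fun n s => by
    rw [← smul_eq_mul, ← deriv_comp_mul_left]
    exact deriv_const_sub 1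
  have hcont : Continuous fun s : ℝ => deriv f s * s :=
    (f.contDiff.continuous_deriv le_rfl).mul continuous_id
  obtain ⟨M, hM⟩ := f.hasCompactSupport.deriv.mul_right.exists_bound_of_continuous hcont
  refine ⟨M, fun n s => ?_⟩
  calc |deriv (cutoff n) s * s| = |deriv f ((n + 1) * s) * ((n + 1) * s)| := by
        rw [hderiv, ← abs_neg]
        congr 1
        ring
    _ ≤ M := hM _

theorem exists_abs_cutoff_mul_add_deriv_mul_le : ∃ M, ∀ n s a b C, |b| ≤ C * |s| →
    |cutoff n s * a + deriv (cutoff n) s * b| ≤ |a| + |C| * M := by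
  obtain ⟨M, hM⟩ := exists_abs_deriv_cutoff_mul_le
  refine ⟨M, fun n s a b C hb => (abs_add_le _ _).trans (add_le_add ?_ ?_)⟩
  · rw [abs_mul]
    exact mul_le_of_le_one_left (abs_nonneg a) (abs_cutoff_le_one n s)
  · calc |deriv (cutoff n) s * b| ≤ |deriv (cutoff n) s| * (|C| * |s|) := by
          rw [abs_mul]
          gcongr
          exact hb.trans (by gcongr; exact le_abs_self C)
      _ = |C| * |deriv (cutoff n) s * s| := by rw [abs_mul]; ring
      _ ≤ |C| * M := by gcongr; exact hM n s

theorem tendsto_cutoff_mul_add_deriv_mul {s a b : ℝ} (ha : s = 0 → a = 0) (hb : s = 0 → b = 0) :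
    Tendsto (fun n => cutoff n s * a + deriv (cutoff n) s * b) atTop (𝓝 a) := by
  by_cases hs : s = 0
  · simp [ha hs, hb hs]
  · refine tendsto_const_nhds.congr' ?_
    filter_upwards [eventually_cutoff_eventuallyEq_one hs] with n hn
    simp [hn.eq_of_nhds, hn.deriv_eq]

section IntegrationByParts

variable {Ω : Set E3} {u : E3 → ℝ} {F : E3 → E3}

theorem setIntegral_dive_comp_smul_eq_zero (hΩo : IsOpen Ω) (hΩb : Bornology.IsBounded Ω)
    (hu : DifferentiableOn ℝ u Ω) (hu0 : ∀ x ∈ frontier Ω, Tendsto u (𝓝[Ω] x) (𝓝 0))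
    (hF : DifferentiableOn ℝ F Ω) {φ : ℝ → ℝ} (hφ : Differentiable ℝ φ) (hφ0 : φ =ᶠ[𝓝 0] 0)
    (hint : IntegrableOn (fun x => φ (u x) * dive F x + deriv φ (u x) * fderiv ℝ u x (F x)) Ω) :
    ∫ x in Ω, (φ (u x) * dive F x + deriv φ (u x) * fderiv ℝ u x (F x)) = 0 := by
  have hφu : ∀ x ∈ Ω, HasFDerivAt (fun y => φ (u y)) (deriv φ (u x) • fderiv ℝ u x) x :=
    fun x hx => (hφ (u x)).hasDerivAt.comp_hasFDerivAt x
      (hu.differentiableAt (hΩo.mem_nhds hx)).hasFDerivAt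
  have hdive : EqOn (dive fun y => φ (u y) • F y)
      (fun x => φ (u x) * dive F x + deriv φ (u x) * fderiv ℝ u x (F x)) Ω := fun x hx => by
    simp [dive_smul (hφu x hx).differentiableAt (hF.differentiableAt (hΩo.mem_nhds hx)),
      (hφu x hx).fderiv]
  rw [← setIntegral_congr_fun hΩo.measurableSet hdive]
  refine setIntegral_dive_eq_zero hΩo hΩb (fun x hx => ?_) (fun x hx => ?_)
    (hint.congr_fun hdive.symm hΩo.measurableSet)
  · exact (hφu x hx).differentiableAt.differentiableWithinAt.smul (hF x hx)
  · filter_upwards [(hu0 x hx).eventually hφ0] with y hy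
    rw [hy, Pi.zero_apply, zero_smul]

-- The field `(cutoff n ∘ u) • F` vanishes near `frontier Ω`, whatever the shape of `Ω`. As `n → ∞`
-- the cutoff only misses the zero set of `u`, where `fderiv ℝ u = 0` almost everywhere.
theorem setIntegral_dive_eq_zero_of_abs_fderiv_le (hΩo : IsOpen Ω) (hΩb : Bornology.IsBounded Ω)
    (hu : ContDiffOn ℝ 1 u Ω) (hu0 : ∀ x ∈ frontier Ω, Tendsto u (𝓝[Ω] x) (𝓝 0))
    (hF : DifferentiableOn ℝ F Ω) (hdive : BddContOn (dive F) Ω) {C : ℝ}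
    (hC : ∀ x ∈ Ω, |fderiv ℝ u x (F x)| ≤ C * |u x|)
    (hcrit : ∀ x ∈ Ω, u x = 0 → fderiv ℝ u x = 0 → dive F x = 0) :
    ∫ x in Ω, dive F x = 0 := by
  let f : ℕ → E3 → ℝ := fun n x =>
    cutoff n (u x) * dive F x + deriv (cutoff n) (u x) * fderiv ℝ u x (F x)
  obtain ⟨D, hD⟩ := hdive.exists_bound
  obtain ⟨M, hM⟩ := exists_abs_cutoff_mul_add_deriv_mul_le
  have hderivF : ContinuousOn (fun x => fderiv ℝ u x (F x)) Ω :=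
    (hu.continuousOn_fderiv_of_isOpen hΩo le_rfl).clm_apply hF.continuousOn
  have hcont : ∀ n, ContinuousOn (f n) Ω := fun n =>
    (((contDiff_cutoff n).continuous.comp_continuousOn hu.continuousOn).mul hdive.continuousOn).add
      ((((contDiff_cutoff n).continuous_deriv le_rfl).comp_continuousOn hu.continuousOn).mul
        hderivF)
  have hbound : ∀ n, ∀ x ∈ Ω, ‖f n x‖ ≤ D + |C| * M := fun n x hx =>
    (hM n (u x) _ _ C (hC x hx)).trans (add_le_add_left (hD x hx) _)
  have hzero : ∀ n, ∫ x in Ω, f n x = 0 := fun n =>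
    setIntegral_dive_comp_smul_eq_zero hΩo hΩb (hu.differentiableOn one_ne_zero) hu0 hF
      ((contDiff_cutoff n).differentiable one_ne_zero) (cutoff_eventuallyEq_zero n)
      (BddContOn.integrableOn ⟨hcont n, _, hbound n⟩ hΩo.measurableSet hΩb.measure_lt_top.ne)
  have hlim : ∀ᵐ x ∂volume.restrict Ω, Tendsto (fun n => f n x) atTop (𝓝 (dive F x)) := by
    filter_upwards [ae_restrict_fderiv_eq_zero_of_eq_zero hΩo hu.continuousOn,
      ae_restrict_mem hΩo.measurableSet] with x hx hxΩ
    exact tendsto_cutoff_mul_add_deriv_mul (fun hux => hcrit x hxΩ hux (hx hux))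
      fun hux => by simp [hx hux]
  have hconv := tendsto_integral_of_dominated_convergence (fun _ => D + |C| * M)
    (fun n => (hcont n).aestronglyMeasurable hΩo.measurableSet)
    (integrableOn_const hΩb.measure_lt_top.ne)
    (fun n => ae_restrict_of_forall_mem hΩo.measurableSet (hbound n)) hlim
  simp only [hzero] at hconv
  exact tendsto_nhds_unique hconv tendsto_const_nhds

theorem setIntegral_mul_dive (hΩo : IsOpen Ω) (hΩb : Bornology.IsBounded Ω)
    (hu : ContDiffOn ℝ 1 u Ω) (hub : BddContOn u Ω)
    (hu0 : ∀ x ∈ frontier Ω, Tendsto u (𝓝[Ω] x) (𝓝 0)) (hF : DifferentiableOn ℝ F Ω)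
    (hdive : BddContOn (dive F) Ω) (huF : BddContOn (fun x => fderiv ℝ u x (F x)) Ω) :
    ∫ x in Ω, u x * dive F x = -∫ x in Ω, fderiv ℝ u x (F x) := by
  have hdiff : ∀ x ∈ Ω, DifferentiableAt ℝ u x := fun x hx =>
    (hu.differentiableOn one_ne_zero).differentiableAt (hΩo.mem_nhds hx)
  have hdiv : EqOn (dive fun y => u y • F y) (fun x => u x * dive F x + fderiv ℝ u x (F x)) Ω :=
    fun x hx => dive_smul (hdiff x hx) (hF.differentiableAt (hΩo.mem_nhds hx))
  obtain ⟨C, hC⟩ := huF.exists_bound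
  have hzero : ∫ x in Ω, dive (fun y => u y • F y) x = 0 := by
    refine setIntegral_dive_eq_zero_of_abs_fderiv_le hΩo hΩb hu hu0
      ((hu.differentiableOn one_ne_zero).smul hF) (((hub.mul hdive).add huF).congr hdiv) (C := C)
      (fun x hx => ?_) (fun x hx hux hdux => ?_)
    · rw [map_smul, smul_eq_mul, abs_mul, mul_comm]
      exact mul_le_mul_of_nonneg_right (hC x hx) (abs_nonneg _)
    · simp [hdiv hx, hux, hdux]
  have hfin : volume Ω ≠ ⊤ := hΩb.measure_lt_top.ne
  rw [setIntegral_congr_fun hΩo.measurableSet hdiv,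
    integral_add ((hub.mul hdive).integrableOn hΩo.measurableSet hfin)
      (huF.integrableOn hΩo.measurableSet hfin)] at hzero
  exact eq_neg_of_add_eq_zero_left hzero

end IntegrationByParts

/-! ### The operator `𝒟` and the energy form -/

theorem cross_cross_self (b g : E3) :
    cross b (cross b g) = inner ℝ b g • b - ‖b‖ ^ 2 • g := by
  rw [← real_inner_self_eq_norm_sq, inner_eq_sum, inner_eq_sum]
  refine ext_three ?_ ?_ ?_ <;> simp <;> ring

theorem gradPerp_eq_sub {B : E3 → E3} {x : E3} (hB : B x ≠ 0) (χ : E3 → ℝ) :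
    gradPerp B χ x =
      gradient χ x - ((‖B x‖ ^ 2)⁻¹ * inner ℝ (B x) (gradient χ x)) • B x := by
  have hB2 : ‖B x‖ ^ 2 ≠ 0 := pow_ne_zero 2 (norm_ne_zero_iff.2 hB)
  rw [gradPerp, cross_cross_self, smul_sub, smul_smul, smul_smul, inv_mul_cancel₀ hB2, one_smul,
    neg_sub]

theorem inner_gradPerp_eq_zero (B : E3 → E3) (χ : E3 → ℝ) (x : E3) :
    inner ℝ (B x) (gradPerp B χ x) = 0 := by
  rw [gradPerp, inner_neg_right, real_inner_smul_right, inner_cross_self_left, mul_zero, neg_zero]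

theorem inner_gradient_gradPerp {B : E3 → E3} {x : E3} (hB : B x ≠ 0) (f g : E3 → ℝ) :
    inner ℝ (gradient f x) (gradPerp B g x) = inner ℝ (gradPerp B f x) (gradPerp B g x) := by
  rw [gradPerp_eq_sub hB f, inner_sub_left, real_inner_smul_left, inner_gradPerp_eq_zero,
    mul_zero, sub_zero]

theorem gradient_add_const (χ : E3 → ℝ) (c : ℝ) : gradient (fun y => χ y + c) = gradient χ := by
  ext1 x
  simp [gradient]

theorem gradPerp_add_const (B : E3 → E3) (χ : E3 → ℝ) (c : ℝ) :
    gradPerp B (fun y => χ y + c) = gradPerp B χ := by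
  ext1 x
  rw [gradPerp, gradPerp, gradient_add_const]

theorem gradPerp_add_mul (B : E3 → E3) {f g : E3 → ℝ} {x : E3} (hf : DifferentiableAt ℝ f x)
    (hg : DifferentiableAt ℝ g x) (s : ℝ) :
    gradPerp B (fun y => f y + s * g y) x = gradPerp B f x + s • gradPerp B g x := by
  have hfderiv : fderiv ℝ (fun y => f y + s * g y) x = fderiv ℝ f x + s • fderiv ℝ g x :=
    (hf.hasFDerivAt.fun_add (hg.hasFDerivAt.const_mul s)).fderiv
  have hgradient : gradient (fun y => f y + s * g y) x = gradient f x + s • gradient g x := by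
    simp [gradient, hfderiv]
  simp only [gradPerp, hgradient, cross_add_right, cross_smul_right, smul_add, neg_add, smul_neg]
  rw [smul_comm]

/-- The field `A_e ∇_⊥ χ / B²` whose divergence enters `𝒟`. -/
def perpField (Ae : E3 → ℝ) (B : E3 → E3) (χ : E3 → ℝ) (y : E3) : E3 :=
  (Ae y / ‖B y‖ ^ 2) • gradPerp B χ y

theorem opD_eq_sub_dive_perpField (lam σ : ℝ) (Ae : E3 → ℝ) (B : E3 → E3) (χ : E3 → ℝ) (x : E3) :
    opD lam σ Ae B χ x = lam * Ae x * χ x - σ * dive (perpField Ae B χ) x := rfl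

theorem opD_add_const (lam σ : ℝ) (Ae : E3 → ℝ) (B : E3 → E3) (χ : E3 → ℝ) (c : ℝ) (x : E3) :
    opD lam σ Ae B (fun y => χ y + c) x = opD lam σ Ae B χ x + lam * Ae x * c := by
  simp only [opD, gradPerp_add_const]
  ring

/-- The symmetric bilinear form `∫ A_e (lam f g + σ ∇_⊥ f · ∇_⊥ g / B²)` polarizing twice the
energy. -/
def form (lam σ : ℝ) (Ω : Set E3) (Ae : E3 → ℝ) (B : E3 → E3) (f g : E3 → ℝ) : ℝ :=
  ∫ x in Ω, Ae x * (lam * (f x * g x) +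
    σ * (inner ℝ (gradPerp B f x) (gradPerp B g x) / ‖B x‖ ^ 2))

theorem form_comm (lam σ : ℝ) (Ω : Set E3) (Ae : E3 → ℝ) (B : E3 → E3) (f g : E3 → ℝ) :
    form lam σ Ω Ae B f g = form lam σ Ω Ae B g f := by
  simp only [form, mul_comm (f _), real_inner_comm]

theorem energy_eq_form (lam σ : ℝ) (Ω : Set E3) (Ae : E3 → ℝ) (B : E3 → E3) (χ : E3 → ℝ) :
    energy lam σ Ω Ae B χ = form lam σ Ω Ae B χ χ / 2 := by
  simp only [energy, form, real_inner_self_eq_norm_sq, ← pow_two]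
  ring

/-- The potential vorticity `𝒟χ / A_e`, on which the enstrophy depends. -/
def potentialVorticity (lam σ : ℝ) (Ae : E3 → ℝ) (B : E3 → E3) (χ : E3 → ℝ) (x : E3) : ℝ :=
  opD lam σ Ae B χ x / Ae x

/-- The standing assumptions on the domain `Ω`, the density `A_e` and the magnetic field `B`. -/
structure Background (Ω : Set E3) (Ae : E3 → ℝ) (B : E3 → E3) : Prop where
  isOpen : IsOpen Ω
  isBounded : Bornology.IsBounded Ω
  contDiffUpTo_density : ContDiffUpTo 2 Ae Ω
  contDiffUpTo_field : ContDiffUpTo 2 B Ω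
  density_pos : ∀ x ∈ closure Ω, 0 < Ae x
  norm_field_pos : ∀ x ∈ closure Ω, 0 < ‖B x‖

namespace Background

variable {Ω : Set E3} {Ae : E3 → ℝ} {B : E3 → E3} {χ f g : E3 → ℝ}

theorem isCompact_closure (bg : Background Ω Ae B) : IsCompact (closure Ω) :=
  bg.isBounded.isCompact_closure

theorem measurableSet (bg : Background Ω Ae B) : MeasurableSet Ω :=
  bg.isOpen.measurableSet

theorem volume_ne_top (bg : Background Ω Ae B) : volume Ω ≠ ⊤ :=
  bg.isBounded.measure_lt_top.ne

theorem integrableOn (bg : Background Ω Ae B) (hf : BddContOn f Ω) : IntegrableOn f Ω :=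
  hf.integrableOn bg.measurableSet bg.volume_ne_top

theorem field_ne_zero (bg : Background Ω Ae B) {x : E3} (hx : x ∈ Ω) : B x ≠ 0 :=
  norm_pos_iff.1 (bg.norm_field_pos x (subset_closure hx))

theorem density_ne_zero (bg : Background Ω Ae B) {x : E3} (hx : x ∈ Ω) : Ae x ≠ 0 :=
  (bg.density_pos x (subset_closure hx)).ne'

theorem bddC1On (bg : Background Ω Ae B) {Y : Type*} [NormedAddCommGroup Y] [NormedSpace ℝ Y]
    {F : E3 → Y} (hF : ContDiffUpTo 2 F Ω) : BddC1On F Ω :=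
  hF.bddC1On one_le_two bg.isOpen bg.isCompact_closure

theorem bddC1On_gradient (bg : Background Ω Ae B) (hχ : ContDiffUpTo 2 χ Ω) :
    BddC1On (gradient χ) Ω :=
  hχ.bddC1On_gradient le_rfl bg.isOpen bg.isCompact_closure

theorem bddContOn_density (bg : Background Ω Ae B) : BddContOn Ae Ω :=
  (bg.bddC1On bg.contDiffUpTo_density).bddContOn

theorem bddContOn_inv_density (bg : Background Ω Ae B) : BddContOn (fun x => (Ae x)⁻¹) Ω :=
  .of_continuousOn_closure
    (bg.contDiffUpTo_density.1.inv₀ fun x hx => (bg.density_pos x hx).ne') bg.isCompact_closure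

theorem bddC1On_inv_norm_field_sq (bg : Background Ω Ae B) :
    BddC1On (fun x => (‖B x‖ ^ 2)⁻¹) Ω := by
  have hinv : ContDiffOn ℝ 1 (fun b : E3 => (‖b‖ ^ 2)⁻¹) {0}ᶜ :=
    (contDiff_norm_sq ℝ).contDiffOn.inv fun b hb => pow_ne_zero 2 (norm_ne_zero_iff.2 hb)
  refine (bg.bddC1On bg.contDiffUpTo_field).comp isOpen_compl_singleton
    (bg.isCompact_closure.image_of_continuousOn bg.contDiffUpTo_field.1) ?_
    (fun x hx => mem_image_of_mem B (subset_closure hx)) hinv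
  rintro _ ⟨x, hx, rfl⟩
  exact norm_pos_iff.1 (bg.norm_field_pos x hx)

theorem bddC1On_density_div_norm_field_sq (bg : Background Ω Ae B) :
    BddC1On (fun x => Ae x / ‖B x‖ ^ 2) Ω :=
  (bg.bddC1On bg.contDiffUpTo_density).mul bg.bddC1On_inv_norm_field_sq

theorem bddC1On_vE (bg : Background Ω Ae B) (hχ : ContDiffUpTo 2 χ Ω) : BddC1On (vE B χ) Ω :=
  bg.bddC1On_inv_norm_field_sq.smul
    ((bg.bddC1On bg.contDiffUpTo_field).cross (bg.bddC1On_gradient hχ))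

theorem bddC1On_gradPerp (bg : Background Ω Ae B) (hχ : ContDiffUpTo 2 χ Ω) :
    BddC1On (gradPerp B χ) Ω :=
  have hB := bg.bddC1On bg.contDiffUpTo_field
  (bg.bddC1On_inv_norm_field_sq.smul (hB.cross (hB.cross (bg.bddC1On_gradient hχ)))).comp_contDiff
    contDiff_neg

theorem bddC1On_perpField (bg : Background Ω Ae B) (hχ : ContDiffUpTo 2 χ Ω) :
    BddC1On (perpField Ae B χ) Ω :=
  bg.bddC1On_density_div_norm_field_sq.smul (bg.bddC1On_gradPerp hχ)

theorem bddContOn_opD (bg : Background Ω Ae B) (lam σ : ℝ) (hχ : ContDiffUpTo 2 χ Ω) :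
    BddContOn (opD lam σ Ae B χ) Ω :=
  ((bg.bddContOn_density.const_mul lam).mul (bg.bddC1On hχ).bddContOn).sub
    ((bg.bddC1On_perpField hχ).bddContOn_dive.const_mul σ)

theorem bddContOn_potentialVorticity (bg : Background Ω Ae B) (lam σ : ℝ)
    (hχ : ContDiffUpTo 2 χ Ω) : BddContOn (potentialVorticity lam σ Ae B χ) Ω :=
  (bg.bddContOn_opD lam σ hχ).mul bg.bddContOn_inv_density

theorem bddContOn_form_integrand (bg : Background Ω Ae B) (lam σ : ℝ)
    (hf : ContDiffUpTo 2 f Ω) (hg : ContDiffUpTo 2 g Ω) :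
    BddContOn (fun x => Ae x * (lam * (f x * g x) +
      σ * (inner ℝ (gradPerp B f x) (gradPerp B g x) / ‖B x‖ ^ 2))) Ω :=
  bg.bddContOn_density.mul ((((bg.bddC1On hf).bddContOn.mul
    (bg.bddC1On hg).bddContOn).const_mul lam).add
      ((((bg.bddC1On_gradPerp hf).bddContOn.inner (bg.bddC1On_gradPerp hg).bddContOn).mul
        bg.bddC1On_inv_norm_field_sq.bddContOn).const_mul σ))

theorem opD_add_mul (bg : Background Ω Ae B) (lam σ : ℝ) (hf : ContDiffUpTo 2 f Ω)
    (hg : ContDiffUpTo 2 g Ω) (s : ℝ) {x : E3} (hx : x ∈ Ω) :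
    opD lam σ Ae B (fun y => f y + s * g y) x =
      opD lam σ Ae B f x + s * opD lam σ Ae B g x := by
  have hadd : perpField Ae B (fun y => f y + s * g y) =ᶠ[𝓝 x]
      fun y => perpField Ae B f y + s • perpField Ae B g y := by
    filter_upwards [bg.isOpen.mem_nhds hx] with y hy
    simp only [perpField, gradPerp_add_mul B ((bg.bddC1On hf).differentiableAt y hy)
      ((bg.bddC1On hg).differentiableAt y hy), smul_add]
    rw [smul_comm]
  have hfd := (bg.bddC1On_perpField hf).differentiableAt x hx
  have hgd := (bg.bddC1On_perpField hg).differentiableAt x hx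
  simp only [opD_eq_sub_dive_perpField, dive_congr hadd, dive_add hfd (hgd.fun_const_smul s),
    dive_const_smul s hgd]
  ring

theorem form_add_mul_left (bg : Background Ω Ae B) (lam σ : ℝ) {h : E3 → ℝ}
    (hf : ContDiffUpTo 2 f Ω) (hg : ContDiffUpTo 2 g Ω) (hh : ContDiffUpTo 2 h Ω) (s : ℝ) :
    form lam σ Ω Ae B (fun x => f x + s * g x) h =
      form lam σ Ω Ae B f h + s * form lam σ Ω Ae B g h := by
  rw [form, form, form, ← integral_const_mul, ← integral_add
    (bg.integrableOn (bg.bddContOn_form_integrand lam σ hf hh))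
    (bg.integrableOn ((bg.bddContOn_form_integrand lam σ hg hh).const_mul s))]
  refine setIntegral_congr_fun bg.measurableSet fun x hx => ?_
  simp only [gradPerp_add_mul B ((bg.bddC1On hf).differentiableAt x hx)
    ((bg.bddC1On hg).differentiableAt x hx), inner_add_left, real_inner_smul_left]
  ring

theorem integral_mul_opD (bg : Background Ω Ae B) (lam σ : ℝ) (hf : ContDiffUpTo 2 f Ω)
    (hf0 : ∀ x ∈ frontier Ω, f x = 0) (hg : ContDiffUpTo 2 g Ω) :
    ∫ x in Ω, f x * opD lam σ Ae B g x = form lam σ Ω Ae B f g := by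
  have hF := bg.bddC1On_perpField hg
  have hfF : BddContOn (fun x => fderiv ℝ f x (perpField Ae B g x)) Ω := by
    simp only [fderiv_apply_eq_inner_gradient]
    exact (bg.bddC1On_gradient hf).bddContOn.inner hF.bddContOn
  have hparts := setIntegral_mul_dive bg.isOpen bg.isBounded (hf.contDiffOn.of_le one_le_two)
    (bg.bddC1On hf).bddContOn (hf.tendsto_nhdsWithin_frontier hf0) hF.differentiableOn
    hF.bddContOn_dive hfF
  have hsum : (∫ x in Ω, f x * opD lam σ Ae B g x) - form lam σ Ω Ae B f g =
      ∫ x in Ω, -σ * (f x * dive (perpField Ae B g) x + fderiv ℝ f x (perpField Ae B g x)) := by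
    rw [form, ← integral_sub
      (bg.integrableOn ((bg.bddC1On hf).bddContOn.mul (bg.bddContOn_opD lam σ hg)))
      (bg.integrableOn (bg.bddContOn_form_integrand lam σ hf hg))]
    refine setIntegral_congr_fun bg.measurableSet fun x hx => ?_
    simp only [opD_eq_sub_dive_perpField, fderiv_apply_eq_inner_gradient]
    rw [perpField, real_inner_smul_right, inner_gradient_gradPerp (bg.field_ne_zero hx)]
    ring
  rw [integral_const_mul, integral_add
    (bg.integrableOn ((bg.bddC1On hf).bddContOn.mul hF.bddContOn_dive)) (bg.integrableOn hfF),
    hparts, neg_add_cancel, mul_zero] at hsum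
  exact sub_eq_zero.1 hsum

end Background

/-! ### The flux of the generalized Hasegawa–Mima equation -/

theorem fderiv_vE_eq_zero (B : E3 → E3) (χ : E3 → ℝ) (x : E3) : fderiv ℝ χ x (vE B χ x) = 0 := by
  rw [fderiv_apply_eq_inner_gradient, vE, real_inner_smul_right, inner_cross_self_right, mul_zero]

theorem fderiv_flux_eq_zero (σ : ℝ) (Ae : E3 → ℝ) (B : E3 → E3) (χ : E3 → ℝ) (x : E3) :
    fderiv ℝ χ x (flux σ Ae B χ x) = 0 := by
  rw [flux, map_smul, fderiv_vE_eq_zero, smul_zero]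

theorem density_smul_vE (Ae : E3 → ℝ) (B : E3 → E3) (χ : E3 → ℝ) :
    (fun y => Ae y • vE B χ y) = fun y => cross ((Ae y / ‖B y‖ ^ 2) • B y) (gradient χ y) := by
  ext1 y
  rw [vE, cross_smul_left, smul_smul, div_eq_mul_inv]

theorem perpField_eq_neg_cross_vE (Ae : E3 → ℝ) (B : E3 → E3) (χ : E3 → ℝ) :
    perpField Ae B χ = fun y => (-1 : ℝ) • cross ((Ae y / ‖B y‖ ^ 2) • B y) (vE B χ y) := by
  ext1 y
  rw [perpField, gradPerp, vE, cross_smul_left, cross_smul_right, smul_neg, neg_one_smul]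

namespace Background

variable {Ω : Set E3} {Ae : E3 → ℝ} {B : E3 → E3} {χ : E3 → ℝ}

theorem bddC1On_density_div_norm_field_sq_smul_field (bg : Background Ω Ae B) :
    BddC1On (fun y => (Ae y / ‖B y‖ ^ 2) • B y) Ω :=
  bg.bddC1On_density_div_norm_field_sq.smul (bg.bddC1On bg.contDiffUpTo_field)

theorem differentiableAt_density_smul_vE (bg : Background Ω Ae B) (hχ : ContDiffUpTo 2 χ Ω)
    {x : E3} (hx : x ∈ Ω) : DifferentiableAt ℝ (fun y => Ae y • vE B χ y) x :=
  ((bg.bddC1On bg.contDiffUpTo_density).smul (bg.bddC1On_vE hχ)).differentiableAt x hx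

theorem dive_density_smul_vE (bg : Background Ω Ae B) (hI : Integrability Ω Ae B)
    (hχ : ContDiffUpTo 2 χ Ω) {x : E3} (hx : x ∈ Ω) : dive (fun y => Ae y • vE B χ y) x = 0 := by
  rw [density_smul_vE,
    dive_cross (bg.bddC1On_density_div_norm_field_sq_smul_field.differentiableAt x hx)
      ((bg.bddC1On_gradient hχ).differentiableAt x hx),
    hI x hx, curl_gradient (hχ.contDiffOn.contDiffAt (bg.isOpen.mem_nhds hx)), inner_zero_right,
    inner_zero_right, sub_zero]

theorem dive_perpField (bg : Background Ω Ae B) (hI : Integrability Ω Ae B)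
    (hχ : ContDiffUpTo 2 χ Ω) {x : E3} (hx : x ∈ Ω) :
    dive (perpField Ae B χ) x = Ae x * (inner ℝ (B x) (curl (vE B χ) x) / ‖B x‖ ^ 2) := by
  have hb := bg.bddC1On_density_div_norm_field_sq_smul_field
  have hv := bg.bddC1On_vE hχ
  rw [perpField_eq_neg_cross_vE, dive_const_smul _ ((hb.cross hv).differentiableAt x hx),
    dive_cross (hb.differentiableAt x hx) (hv.differentiableAt x hx), hI x hx, inner_zero_right,
    real_inner_smul_left]
  ring

theorem flux_eq_smul (bg : Background Ω Ae B) (lam σ : ℝ) (hI : Integrability Ω Ae B)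
    (hχ : ContDiffUpTo 2 χ Ω) {x : E3} (hx : x ∈ Ω) :
    flux σ Ae B χ x =
      (lam * χ x - 1 - potentialVorticity lam σ Ae B χ x) • (Ae x • vE B χ x) := by
  have hA := bg.density_ne_zero hx
  rw [flux, smul_smul, potentialVorticity, opD_eq_sub_dive_perpField, bg.dive_perpField hI hχ hx]
  congr 1
  field_simp
  ring

theorem potentialVorticity_smul_eventuallyEq (bg : Background Ω Ae B) (lam σ : ℝ)
    (hI : Integrability Ω Ae B) (hχ : ContDiffUpTo 2 χ Ω) {x : E3} (hx : x ∈ Ω) :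
    (fun y => potentialVorticity lam σ Ae B χ y • (Ae y • vE B χ y)) =ᶠ[𝓝 x]
      fun y => (lam * χ y - 1) • (Ae y • vE B χ y) + (-1 : ℝ) • flux σ Ae B χ y := by
  filter_upwards [bg.isOpen.mem_nhds hx] with y hy
  rw [bg.flux_eq_smul lam σ hI hχ hy]
  module

theorem differentiableAt_potentialVorticity_smul (bg : Background Ω Ae B) (lam : ℝ) {σ : ℝ}
    (hI : Integrability Ω Ae B) (hχ : ContDiffUpTo 2 χ Ω)
    (hflux : DifferentiableOn ℝ (flux σ Ae B χ) Ω) {x : E3} (hx : x ∈ Ω) :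
    DifferentiableAt ℝ (fun y => potentialVorticity lam σ Ae B χ y • (Ae y • vE B χ y)) x :=
  have hχd := (bg.bddC1On hχ).differentiableAt x hx
  have hV := bg.differentiableAt_density_smul_vE hχ hx
  have hfluxd := hflux.differentiableAt (bg.isOpen.mem_nhds hx)
  ((((hχd.const_mul lam).sub_const 1).fun_smul hV).fun_add
    (hfluxd.fun_const_smul (-1 : ℝ))).congr_of_eventuallyEq
      (bg.potentialVorticity_smul_eventuallyEq lam σ hI hχ hx)

theorem dive_potentialVorticity_smul (bg : Background Ω Ae B) (lam : ℝ) {σ : ℝ}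
    (hI : Integrability Ω Ae B) (hχ : ContDiffUpTo 2 χ Ω)
    (hflux : DifferentiableOn ℝ (flux σ Ae B χ) Ω) {x : E3} (hx : x ∈ Ω) :
    dive (fun y => potentialVorticity lam σ Ae B χ y • (Ae y • vE B χ y)) x =
      -dive (flux σ Ae B χ) x := by
  have hχd := (bg.bddC1On hχ).differentiableAt x hx
  have hV := bg.differentiableAt_density_smul_vE hχ hx
  have hfluxd := hflux.differentiableAt (bg.isOpen.mem_nhds hx)
  have hfderiv : fderiv ℝ (fun y => lam * χ y - 1) x = lam • fderiv ℝ χ x :=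
    ((hχd.hasFDerivAt.const_mul lam).sub_const 1).fderiv
  have hχ1 : DifferentiableAt ℝ (fun y => lam * χ y - 1) x := (hχd.const_mul lam).sub_const 1
  rw [dive_congr (bg.potentialVorticity_smul_eventuallyEq lam σ hI hχ hx),
    dive_add (hχ1.fun_smul hV) (hfluxd.fun_const_smul (-1 : ℝ)), dive_smul hχ1 hV,
    dive_const_smul _ hfluxd, bg.dive_density_smul_vE hI hχ hx, hfderiv]
  simp [fderiv_vE_eq_zero]

theorem integral_add_mul_dive_flux (bg : Background Ω Ae B) {σ γ : ℝ}
    (hχ : ContDiffUpTo 2 χ Ω) (hχγ : ∀ x ∈ frontier Ω, χ x + γ = 0)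
    (hflux : DifferentiableOn ℝ (flux σ Ae B χ) Ω)
    (hdive : BddContOn (dive (flux σ Ae B χ)) Ω) :
    ∫ x in Ω, (χ x + γ) * dive (flux σ Ae B χ) x = 0 := by
  have hU : ContDiffUpTo 2 (fun x => χ x + γ) Ω := hχ.add_const γ
  have htangent : ∀ x, fderiv ℝ (fun x => χ x + γ) x (flux σ Ae B χ x) = 0 := fun x => by
    rw [fderiv_add_const, fderiv_flux_eq_zero]
  rw [setIntegral_mul_dive bg.isOpen bg.isBounded (hU.contDiffOn.of_le one_le_two)
    (bg.bddC1On hU).bddContOn (hU.tendsto_nhdsWithin_frontier hχγ) hflux hdive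
    (by simpa only [htangent] using .const 0)]
  simp only [htangent, integral_zero, neg_zero]

-- By the chain rule the integrand is minus the divergence of `w(q) A_e v_E`, where `q` is the
-- potential vorticity, and this field is tangent to the level sets of `χ`.
theorem integral_deriv_potentialVorticity_mul_dive_flux (bg : Background Ω Ae B) (lam : ℝ)
    {σ γ : ℝ} (hI : Integrability Ω Ae B) (hχ : ContDiffUpTo 2 χ Ω)
    (hχγ : ∀ x ∈ frontier Ω, χ x + γ = 0) (hflux : DifferentiableOn ℝ (flux σ Ae B χ) Ω)
    (hdive : BddContOn (dive (flux σ Ae B χ)) Ω) {w : ℝ → ℝ} (hw : ContDiff ℝ 1 w) :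
    ∫ x in Ω, deriv w (potentialVorticity lam σ Ae B χ x) * dive (flux σ Ae B χ) x = 0 := by
  set q := potentialVorticity lam σ Ae B χ
  let V : E3 → E3 := fun y => Ae y • vE B χ y
  have hwd : Differentiable ℝ w := hw.differentiable one_ne_zero
  have hU : ContDiffUpTo 2 (fun x => χ x + γ) Ω := hχ.add_const γ
  have hq : BddContOn q Ω := bg.bddContOn_potentialVorticity lam σ hχ
  have hqc : ∀ x ∈ Ω, ContinuousAt q x := fun x hx =>
    hq.continuousOn.continuousAt (bg.isOpen.mem_nhds hx)
  have hV : ∀ x ∈ Ω, DifferentiableAt ℝ V x := fun x => bg.differentiableAt_density_smul_vE hχ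
  have hqV : ∀ x ∈ Ω, DifferentiableAt ℝ (fun y => q y • V y) x := fun x =>
    bg.differentiableAt_potentialVorticity_smul lam hI hχ hflux
  have hdiveV : ∀ x ∈ Ω, dive V x = 0 := fun x => bg.dive_density_smul_vE hI hχ
  have hchain : ∀ x ∈ Ω, dive (fun y => w (q y) • V y) x =
      -(deriv w (q x) * dive (flux σ Ae B χ) x) := fun x hx => by
    rw [dive_comp_smul (hqc x hx) (hV x hx) (hqV x hx) (hwd (q x)) (hdiveV x hx),
      bg.dive_potentialVorticity_smul lam hI hχ hflux hx, mul_neg]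
  have hzero : ∫ x in Ω, dive (fun y => w (q y) • V y) x = 0 := by
    refine setIntegral_dive_eq_zero_of_abs_fderiv_le (C := 0) bg.isOpen bg.isBounded
      (hU.contDiffOn.of_le one_le_two) (hU.tendsto_nhdsWithin_frontier hχγ)
      (fun x hx => (differentiableAt_comp_smul (hqc x hx) (hV x hx) (hqV x hx)
        (hwd (q x))).differentiableWithinAt)
      (((hq.comp (hw.continuous_deriv le_rfl)).mul hdive).neg.congr hchain)
      (fun x _ => by simp [V, fderiv_vE_eq_zero]) (fun x hx _ hfderiv => ?_)
    rw [fderiv_add_const] at hfderiv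
    have hV0 : V x = 0 := by simp [V, vE, gradient, hfderiv, cross_zero_right]
    rw [dive_smul_of_eq_zero ((hwd (q x)).continuousAt.comp' (hqc x hx)) (hV x hx) hV0,
      hdiveV x hx, mul_zero]
  rw [setIntegral_congr_fun bg.measurableSet hchain, integral_neg, neg_eq_zero] at hzero
  exact hzero

end Background

/-! ### Differentiation under the integral sign -/

section DifferentiationUnderIntegral

variable {α : Type*} [MeasurableSpace α] {μ : Measure α} [IsFiniteMeasure μ] {I : Set ℝ} {t : ℝ}

theorem tendsto_integral_mul_slope (hI : Convex ℝ I) (ht : t ∈ I) {k f f' : ℝ → α → ℝ} {K M : ℝ}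
    (hk : ∀ s ∈ I, AEStronglyMeasurable (k s) μ) (hkK : ∀ s ∈ I, ∀ᵐ x ∂μ, |k s x| ≤ K)
    (hkt : ∀ᵐ x ∂μ, ContinuousWithinAt (fun s => k s x) I t)
    (hf : ∀ s ∈ I, AEStronglyMeasurable (f s) μ)
    (hf' : ∀ᵐ x ∂μ, ∀ s ∈ I, HasDerivWithinAt (fun r => f r x) (f' s x) I s)
    (hM : ∀ᵐ x ∂μ, ∀ s ∈ I, |f' s x| ≤ M) :
    Tendsto (fun s => ∫ x, k s x * slope (fun r => f r x) t s ∂μ) (𝓝[I \ {t}] t)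
      (𝓝 (∫ x, k t x * f' t x ∂μ)) := by
  refine tendsto_integral_filter_of_dominated_convergence (fun _ => K * M) ?_ ?_
    (integrable_const _) ?_
  · filter_upwards [self_mem_nhdsWithin] with s hs
    simp only [slope_def_module]
    exact (hk s hs.1).mul (((hf s hs.1).sub (hf t ht)).const_smul (s - t)⁻¹)
  · filter_upwards [self_mem_nhdsWithin] with s hs
    filter_upwards [hkK s hs.1, hf', hM] with x hkx hfx hMx
    have hst : 0 < |s - t| := abs_pos.2 (sub_ne_zero.2 hs.2)
    have hslope : |slope (fun r => f r x) t s| ≤ M := by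
      rw [slope_def_field, abs_div, div_le_iff₀ hst]
      exact hI.norm_image_sub_le_of_norm_hasDerivWithin_le hfx hMx ht hs.1
    rw [norm_mul]
    exact mul_le_mul hkx hslope (norm_nonneg _) ((abs_nonneg _).trans hkx)
  · filter_upwards [hkt, hf'] with x hkx hfx
    exact (hkx.tendsto.mono_left (nhdsWithin_mono t sdiff_subset)).mul
      (hasDerivWithinAt_iff_tendsto_slope.1 (hfx t ht))

theorem hasDerivWithinAt_integral (hI : Convex ℝ I) (ht : t ∈ I) {f f' : ℝ → α → ℝ} {M : ℝ}
    (hf : ∀ s ∈ I, Integrable (f s) μ)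
    (hf' : ∀ᵐ x ∂μ, ∀ s ∈ I, HasDerivWithinAt (fun r => f r x) (f' s x) I s)
    (hM : ∀ᵐ x ∂μ, ∀ s ∈ I, |f' s x| ≤ M) :
    HasDerivWithinAt (fun s => ∫ x, f s x ∂μ) (∫ x, f' t x ∂μ) I t := by
  rw [hasDerivWithinAt_iff_tendsto_slope]
  have hslope := tendsto_integral_mul_slope (k := fun _ _ => 1) (K := 1) hI ht
    (fun _ _ => aestronglyMeasurable_const) (fun _ _ => ae_of_all _ fun _ => abs_one.le)
    (ae_of_all _ fun _ => continuousWithinAt_const) (fun s hs => (hf s hs).1) hf' hM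
  simp only [one_mul] at hslope
  refine hslope.congr' ?_
  filter_upwards [self_mem_nhdsWithin] with s hs
  simp only [slope_def_module, smul_eq_mul]
  rw [integral_const_mul, integral_sub (hf s hs.1) (hf t ht)]

end DifferentiationUnderIntegral

theorem eq_of_hasDerivWithinAt_zero {f : ℝ → ℝ} {I : Set ℝ} (hI : Convex ℝ I)
    (hf : ∀ t ∈ I, HasDerivWithinAt f 0 I t) {s t : ℝ} (hs : s ∈ I) (ht : t ∈ I) : f s = f t := by
  have h := hI.norm_image_sub_le_of_norm_hasDerivWithin_le hf (fun _ _ => norm_zero.le) ht hs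
  simpa [sub_eq_zero] using h

theorem exists_forall_abs_le_of_hasDerivWithinAt {X : Type*} {S : Set X} {f f' : ℝ → X → ℝ}
    {a b t C M : ℝ} (ht : t ∈ Icc a b) (hC : ∀ x ∈ S, |f t x| ≤ C)
    (hf : ∀ x ∈ S, ∀ s ∈ Icc a b, HasDerivWithinAt (fun r => f r x) (f' s x) (Icc a b) s)
    (hM : ∀ x ∈ S, ∀ s ∈ Icc a b, |f' s x| ≤ M) :
    ∃ R, ∀ x ∈ S, ∀ s ∈ Icc a b, |f s x| ≤ R := by
  refine ⟨C + M * (b - a), fun x hx s hs => ?_⟩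
  have hM0 : 0 ≤ M := (abs_nonneg _).trans (hM x hx s hs)
  calc |f s x| ≤ |f t x| + |f s x - f t x| := by
        linarith [abs_sub_abs_le_abs_sub (f s x) (f t x)]
    _ ≤ |f t x| + M * |s - t| := by
        gcongr
        exact (convex_Icc a b).norm_image_sub_le_of_norm_hasDerivWithin_le (hf x hx) (hM x hx) ht hs
    _ ≤ C + M * (b - a) := by
        gcongr
        · exact hC x hx
        · exact abs_sub_le_of_le_of_le hs.1 hs.2 ht.1 ht.2

theorem Background.hasDerivWithinAt_integral_density_mul_comp {Ω : Set E3} {Ae : E3 → ℝ}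
    {B : E3 → E3} (bg : Background Ω Ae B) {W : ℝ → ℝ} (hW : ContDiff ℝ 1 W) {a b t M : ℝ}
    (ht : t ∈ Icc a b) {D D' : ℝ → E3 → ℝ} (hD : ∀ s ∈ Icc a b, BddContOn (D s) Ω)
    (hD' : ∀ x ∈ Ω, ∀ s ∈ Icc a b, HasDerivWithinAt (fun r => D r x) (D' s x) (Icc a b) s)
    (hM : ∀ x ∈ Ω, ∀ s ∈ Icc a b, |D' s x| ≤ M) :
    HasDerivWithinAt (fun s => ∫ x in Ω, Ae x * W (D s x / Ae x))
      (∫ x in Ω, deriv W (D t x / Ae x) * D' t x) (Icc a b) t := by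
  have : IsFiniteMeasure (volume.restrict Ω) := ⟨by simpa using bg.volume_ne_top.lt_top⟩
  have hWd : Differentiable ℝ W := hW.differentiable one_ne_zero
  obtain ⟨C, hC⟩ := (hD t ht).exists_bound
  obtain ⟨Q, hQ⟩ := exists_forall_abs_le_of_hasDerivWithinAt ht hC hD' hM
  obtain ⟨A, hA⟩ := bg.bddContOn_inv_density.exists_bound
  have hq : ∀ x ∈ Ω, ∀ s ∈ Icc a b, |D s x / Ae x| ≤ Q * A := fun x hx s hs => by
    rw [div_eq_mul_inv, abs_mul]
    exact mul_le_mul (hQ x hx s hs) (hA x hx) (abs_nonneg _) ((abs_nonneg _).trans (hQ x hx s hs))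
  obtain ⟨R, hR⟩ := isCompact_Icc.exists_bound_of_continuousOn
    (hW.continuous_deriv le_rfl).continuousOn (s := Icc (-(Q * A)) (Q * A))
  refine hasDerivWithinAt_integral (M := R * M)
    (f' := fun s x => deriv W (D s x / Ae x) * D' s x) (convex_Icc a b) ht
    (fun s hs => bg.integrableOn
      (bg.bddContOn_density.mul (((hD s hs).mul bg.bddContOn_inv_density).comp hW.continuous)))
    (ae_restrict_of_forall_mem bg.measurableSet fun x hx s hs => ?_)
    (ae_restrict_of_forall_mem bg.measurableSet fun x hx s hs => ?_)
  · have hAe := bg.density_ne_zero hx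
    refine (((hWd _).hasDerivAt.comp_hasDerivWithinAt s
      ((hD' x hx s hs).div_const (Ae x))).const_mul (Ae x)).congr_deriv ?_
    field_simp
  · have hRx := hR _ (abs_le.1 (hq x hx s hs))
    rw [abs_mul]
    exact mul_le_mul hRx (hM x hx s hs) (abs_nonneg _) ((norm_nonneg _).trans hRx)

/-! ### Critical points of the energy-Casimir functional -/

/-- The functional `H_Ω[χ + γ] + W_Ω[χ]`. With `W = ν w` it differs from the energy-Casimir
functional by a constant, and `χ + γ` vanishes on the boundary for the fields of interest. -/
def shiftedCasimir (lam σ : ℝ) (Ω : Set E3) (Ae : E3 → ℝ) (B : E3 → E3) (γ : ℝ) (W : ℝ → ℝ)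
    (χ : E3 → ℝ) : ℝ :=
  energy lam σ Ω Ae B (fun x => χ x + γ) + enstrophy lam σ Ω Ae B W χ

theorem enstrophy_const_mul (lam σ : ℝ) (Ω : Set E3) (Ae : E3 → ℝ) (B : E3 → E3) (ν : ℝ)
    (w : ℝ → ℝ) (χ : E3 → ℝ) :
    enstrophy lam σ Ω Ae B (fun s => ν * w s) χ = ν * enstrophy lam σ Ω Ae B w χ := by
  simp only [enstrophy, ← integral_const_mul, mul_left_comm]

namespace Background

variable {Ω : Set E3} {Ae : E3 → ℝ} {B : E3 → E3} {χ f g h : E3 → ℝ} {W : ℝ → ℝ}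

theorem energy_add_const (bg : Background Ω Ae B) (lam σ γ : ℝ) (hχ : ContDiffUpTo 2 χ Ω) :
    energy lam σ Ω Ae B (fun x => χ x + γ) =
      energy lam σ Ω Ae B χ + γ * mass lam Ω Ae χ + (lam * γ ^ 2 / 2 - γ) * ∫ x in Ω, Ae x := by
  have hmass : BddContOn (fun x => Ae x * (1 + lam * χ x)) Ω :=
    bg.bddContOn_density.mul ((BddContOn.const 1).add ((bg.bddC1On hχ).bddContOn.const_mul lam))
  have hform := bg.bddContOn_form_integrand lam σ hχ hχ
  rw [energy_eq_form, energy_eq_form, form, form, mass, div_eq_inv_mul, div_eq_inv_mul,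
    ← integral_const_mul, ← integral_const_mul, ← integral_const_mul, ← integral_const_mul,
    ← integral_add (bg.integrableOn (hform.const_mul _)) (bg.integrableOn (hmass.const_mul γ)),
    ← integral_add (bg.integrableOn ((hform.const_mul _).add (hmass.const_mul γ)))
      (bg.integrableOn (bg.bddContOn_density.const_mul _))]
  congr 1 with x
  rw [gradPerp_add_const]
  ring

theorem energyCasimir_eq_shiftedCasimir_sub (bg : Background Ω Ae B) (lam σ γ ν : ℝ) (w : ℝ → ℝ)
    (hχ : ContDiffUpTo 2 χ Ω) :
    energyCasimir lam σ Ω Ae B γ ν w χ = shiftedCasimir lam σ Ω Ae B γ (fun s => ν * w s) χ -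
      (lam * γ ^ 2 / 2 - γ) * ∫ x in Ω, Ae x := by
  rw [energyCasimir, shiftedCasimir, bg.energy_add_const lam σ γ hχ, enstrophy_const_mul]
  ring

theorem form_add_mul_self (bg : Background Ω Ae B) (lam σ : ℝ) (hf : ContDiffUpTo 2 f Ω)
    (hg : ContDiffUpTo 2 g Ω) (s : ℝ) :
    form lam σ Ω Ae B (fun x => f x + s * g x) (fun x => f x + s * g x) =
      form lam σ Ω Ae B f f + 2 * s * form lam σ Ω Ae B f g + s ^ 2 * form lam σ Ω Ae B g g := by
  rw [bg.form_add_mul_left lam σ hf hg (hf.add (hg.const_mul s)), form_comm _ _ _ _ _ f,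
    form_comm _ _ _ _ _ g,
    bg.form_add_mul_left lam σ hf hg hf, bg.form_add_mul_left lam σ hf hg hg,
    form_comm lam σ Ω Ae B g f]
  ring

theorem hasDerivAt_energy_add_mul (bg : Background Ω Ae B) (lam σ : ℝ) (hf : ContDiffUpTo 2 f Ω)
    (hg : ContDiffUpTo 2 g Ω) :
    HasDerivAt (fun s : ℝ => energy lam σ Ω Ae B fun x => f x + s * g x)
      (form lam σ Ω Ae B f g) 0 := by
  simp only [energy_eq_form, bg.form_add_mul_self lam σ hf hg]
  refine ((((((hasDerivAt_id (0 : ℝ)).const_mul 2).mul_const _).const_add _).add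
    (((hasDerivAt_id (0 : ℝ)).pow 2).mul_const _)).div_const 2).congr_deriv ?_
  simp

theorem hasDerivAt_enstrophy_add_mul (bg : Background Ω Ae B) (lam σ : ℝ)
    (hW : ContDiff ℝ 1 W) (hf : ContDiffUpTo 2 f Ω) (hg : ContDiffUpTo 2 g Ω) :
    HasDerivAt (fun s : ℝ => enstrophy lam σ Ω Ae B W fun x => f x + s * g x)
      (∫ x in Ω, deriv W (potentialVorticity lam σ Ae B f x) * opD lam σ Ae B g x) 0 := by
  have hDf := bg.bddContOn_opD lam σ hf
  have hDg := bg.bddContOn_opD lam σ hg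
  obtain ⟨M, hM⟩ := hDg.exists_bound
  have henstrophy : ∀ s : ℝ, enstrophy lam σ Ω Ae B W (fun x => f x + s * g x) =
      ∫ x in Ω, Ae x * W ((opD lam σ Ae B f x + s * opD lam σ Ae B g x) / Ae x) := fun s =>
    setIntegral_congr_fun bg.measurableSet fun x hx => by
      simp only [bg.opD_add_mul lam σ hf hg s hx]
  have hderiv := bg.hasDerivWithinAt_integral_density_mul_comp hW (a := -1) (b := 1) (t := 0)
    (D := fun s x => opD lam σ Ae B f x + s * opD lam σ Ae B g x)
    (D' := fun _ => opD lam σ Ae B g) (by norm_num) (fun s _ => hDf.add (hDg.const_mul s))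
    (fun x _ s _ => by
      simpa using (((hasDerivAt_id s).mul_const (opD lam σ Ae B g x)).const_add
        (opD lam σ Ae B f x)).hasDerivWithinAt)
    (fun x hx _ _ => hM x hx)
  simp only [henstrophy]
  simpa [potentialVorticity] using
    hderiv.hasDerivAt (Icc_mem_nhds neg_one_lt_zero zero_lt_one)

theorem eulerLagrange_of_isCritical (bg : Background Ω Ae B) {lam σ γ ν : ℝ} {w : ℝ → ℝ}
    (hw : ContDiff ℝ 1 fun s => ν * w s) (hχ : ContDiffUpTo 2 χ Ω)
    (hcrit : IsCritical lam σ Ω Ae B γ ν w χ) (hh : ContDiffUpTo 2 h Ω)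
    (hh0 : ∀ x ∈ frontier Ω, h x = 0) :
    form lam σ Ω Ae B (fun x => χ x + γ) h +
      ∫ x in Ω, deriv (fun s => ν * w s) (potentialVorticity lam σ Ae B χ x) *
        opD lam σ Ae B h x = 0 := by
  have hshift : ∀ s : ℝ, energyCasimir lam σ Ω Ae B γ ν w (fun x => χ x + s * h x) =
      energy lam σ Ω Ae B (fun x => χ x + γ + s * h x) +
        enstrophy lam σ Ω Ae B (fun s => ν * w s) (fun x => χ x + s * h x) -
          (lam * γ ^ 2 / 2 - γ) * ∫ x in Ω, Ae x := fun s => by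
    simp only [bg.energyCasimir_eq_shiftedCasimir_sub lam σ γ ν w (hχ.add (hh.const_mul s)),
      shiftedCasimir, add_right_comm]
  have hzero := hcrit h hh hh0
  simp only [hshift] at hzero
  exact (((bg.hasDerivAt_energy_add_mul lam σ (hχ.add_const γ) hh).add
    (bg.hasDerivAt_enstrophy_add_mul lam σ hw hχ hh)).sub_const _).unique hzero

end Background

/-! ### Conservation laws -/

namespace Background

variable {Ω : Set E3} {Ae : E3 → ℝ} {B : E3 → E3} {f g : E3 → ℝ}

theorem form_self_sub_form_self (bg : Background Ω Ae B) (lam σ : ℝ) (hf : ContDiffUpTo 2 f Ω)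
    (hf0 : ∀ x ∈ frontier Ω, f x = 0) (hg : ContDiffUpTo 2 g Ω)
    (hg0 : ∀ x ∈ frontier Ω, g x = 0) :
    form lam σ Ω Ae B f f - form lam σ Ω Ae B g g =
      ∫ x in Ω, (f x + g x) * (opD lam σ Ae B f x - opD lam σ Ae B g x) := by
  have hfg := hf.add hg
  have hfg0 : ∀ x ∈ frontier Ω, f x + g x = 0 := fun x hx => by rw [hf0 x hx, hg0 x hx, add_zero]
  have hlinear : ∀ {h : E3 → ℝ}, ContDiffUpTo 2 h Ω → form lam σ Ω Ae B (fun x => f x + g x) h =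
      form lam σ Ω Ae B f h + form lam σ Ω Ae B g h := fun hh => by
    simpa only [one_mul] using bg.form_add_mul_left lam σ hf hg hh 1
  simp only [mul_sub]
  rw [integral_sub
      (bg.integrableOn ((bg.bddC1On hfg).bddContOn.mul (bg.bddContOn_opD lam σ hf)))
      (bg.integrableOn ((bg.bddC1On hfg).bddContOn.mul (bg.bddContOn_opD lam σ hg))),
    bg.integral_mul_opD lam σ hfg hfg0 hf, bg.integral_mul_opD lam σ hfg hfg0 hg, hlinear hf,
    hlinear hg, form_comm lam σ Ω Ae B g f]
  ring

-- By `form_self_sub_form_self` the difference quotient of the form is an integral against that of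
-- `𝒟 (U t)`; the gradient of `U t` is never differentiated in time.
theorem hasDerivWithinAt_form_self (bg : Background Ω Ae B) (lam σ : ℝ) {U D' : ℝ → E3 → ℝ}
    {a b t K M : ℝ} (ht : t ∈ Icc a b) (hU : ∀ s ∈ Icc a b, ContDiffUpTo 2 (U s) Ω)
    (hU0 : ∀ s ∈ Icc a b, ∀ x ∈ frontier Ω, U s x = 0)
    (hK : ∀ s ∈ Icc a b, ∀ x ∈ Ω, |U s x| ≤ K)
    (hUt : ∀ x ∈ Ω, ContinuousWithinAt (fun s => U s x) (Icc a b) t)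
    (hD' : ∀ x ∈ Ω, ∀ s ∈ Icc a b,
      HasDerivWithinAt (fun r => opD lam σ Ae B (U r) x) (D' s x) (Icc a b) s)
    (hM : ∀ x ∈ Ω, ∀ s ∈ Icc a b, |D' s x| ≤ M) :
    HasDerivWithinAt (fun s => form lam σ Ω Ae B (U s) (U s))
      (2 * ∫ x in Ω, U t x * D' t x) (Icc a b) t := by
  have : IsFiniteMeasure (volume.restrict Ω) := ⟨by simpa using bg.volume_ne_top.lt_top⟩
  have hΩ := bg.measurableSet
  have hlim := tendsto_integral_mul_slope (μ := volume.restrict Ω) (convex_Icc a b) ht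
    (k := fun s x => U s x + U t x) (f := fun s => opD lam σ Ae B (U s)) (K := K + K)
    (fun s hs => (bg.integrableOn (bg.bddC1On ((hU s hs).add (hU t ht))).bddContOn).1)
    (fun s hs => ae_restrict_of_forall_mem hΩ fun x hx =>
      (abs_add_le _ _).trans (add_le_add (hK s hs x hx) (hK t ht x hx)))
    (ae_restrict_of_forall_mem hΩ fun x hx => (hUt x hx).add continuousWithinAt_const)
    (fun s hs => (bg.integrableOn (bg.bddContOn_opD lam σ (hU s hs))).1)
    (ae_restrict_of_forall_mem hΩ hD') (ae_restrict_of_forall_mem hΩ hM)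
  rw [hasDerivWithinAt_iff_tendsto_slope, ← integral_const_mul]
  simp only [← two_mul, mul_assoc] at hlim
  refine hlim.congr' ?_
  filter_upwards [self_mem_nhdsWithin] with s hs
  rw [slope_def_field, bg.form_self_sub_form_self lam σ (hU s hs.1) (hU0 s hs.1) (hU t ht)
    (hU0 t ht), div_eq_inv_mul, ← integral_const_mul]
  simp only [slope_def_field, div_eq_inv_mul, mul_left_comm]

end Background

namespace IsSolution

variable {lam σ : ℝ} {Ω : Set E3} {Ae : E3 → ℝ} {B : E3 → E3} {χ : ℝ → E3 → ℝ}

theorem contDiffUpTo_slice (sol : IsSolution lam σ Ω Ae B χ) {t : ℝ} (ht : 0 ≤ t) :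
    ContDiffUpTo 2 (χ t) Ω :=
  sol.contDiff.slice ht

theorem exists_dive_flux_bound (sol : IsSolution lam σ Ω Ae B χ) (hΩ : IsCompact (closure Ω))
    (T : ℝ) : ∃ M, ∀ x ∈ Ω, ∀ s ∈ Icc 0 T, |dive (flux σ Ae B (χ s)) x| ≤ M := by
  obtain ⟨g, hg, hgeq⟩ := sol.rhs_cont
  obtain ⟨M, hM⟩ := (isCompact_Icc.prod hΩ).exists_bound_of_continuousOn
    (hg.mono (prod_mono (fun _ hs => hs.1 : Icc 0 T ⊆ Ici 0) subset_rfl))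
  refine ⟨M, fun x hx s hs => ?_⟩
  rw [← hgeq s hs.1 x hx]
  exact hM (s, x) ⟨hs, subset_closure hx⟩

theorem bddContOn_dive_flux (sol : IsSolution lam σ Ω Ae B χ) (hΩ : IsCompact (closure Ω)) {t : ℝ}
    (ht : 0 ≤ t) : BddContOn (dive (flux σ Ae B (χ t))) Ω := by
  obtain ⟨g, hg, hgeq⟩ := sol.rhs_cont
  have hgt : BddContOn (fun x => g (t, x)) Ω := .of_continuousOn_closure
    (hg.comp (Continuous.prodMk_right t).continuousOn fun x hx => ⟨ht, hx⟩) hΩ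
  exact hgt.congr fun x hx => (hgeq t ht x hx).symm

theorem continuousOn_uncurry (sol : IsSolution lam σ Ω Ae B χ) :
    ContinuousOn (Function.uncurry χ) (Ici 0 ×ˢ closure Ω) := by
  simpa only [closure_prod_eq, closure_Ici] using sol.contDiff.1

theorem exists_bound (sol : IsSolution lam σ Ω Ae B χ) (hΩ : IsCompact (closure Ω)) (T : ℝ) :
    ∃ K, ∀ s ∈ Icc 0 T, ∀ x ∈ Ω, |χ s x| ≤ K := by
  obtain ⟨K, hK⟩ := (isCompact_Icc.prod hΩ).exists_bound_of_continuousOn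
    (sol.continuousOn_uncurry.mono (prod_mono (fun _ hs => hs.1 : Icc 0 T ⊆ Ici 0) subset_rfl))
  exact ⟨K, fun s hs x hx => hK (s, x) ⟨hs, subset_closure hx⟩⟩

theorem continuousOn_time (sol : IsSolution lam σ Ω Ae B χ) {x : E3} (hx : x ∈ Ω) :
    ContinuousOn (fun s => χ s x) (Ici 0) :=
  sol.continuousOn_uncurry.comp (Continuous.prodMk_left x).continuousOn
    fun _ hs => ⟨hs, subset_closure hx⟩

theorem energy_eq_initial (sol : IsSolution lam σ Ω Ae B χ) (bg : Background Ω Ae B) {γ : ℝ}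
    (hχγ : ∀ t, 0 ≤ t → ∀ x ∈ frontier Ω, χ t x + γ = 0) {t : ℝ} (ht : 0 ≤ t) :
    energy lam σ Ω Ae B (fun x => χ t x + γ) = energy lam σ Ω Ae B (fun x => χ 0 x + γ) := by
  obtain ⟨M, hM⟩ := sol.exists_dive_flux_bound bg.isCompact_closure t
  obtain ⟨K, hK⟩ := sol.exists_bound bg.isCompact_closure t
  have hderiv : ∀ s ∈ Icc 0 t, HasDerivWithinAt
      (fun s => form lam σ Ω Ae B (fun x => χ s x + γ) (fun x => χ s x + γ)) 0 (Icc 0 t) s :=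
    fun s hs => by
      refine (bg.hasDerivWithinAt_form_self lam σ (U := fun s x => χ s x + γ) (K := K + |γ|) hs
        (fun r hr => (sol.contDiffUpTo_slice hr.1).add_const γ) (fun r hr => hχγ r hr.1)
        (fun r hr x hx => (abs_add_le _ _).trans (add_le_add_left (hK r hr x hx) _))
        (fun x hx => (((sol.continuousOn_time hx).mono Icc_subset_Ici_self) s hs).add_const γ)
        (fun x hx r hr => ?_) hM).congr_deriv ?_
      · simp only [opD_add_const]
        exact ((sol.equation r hr.1 x hx).mono Icc_subset_Ici_self).add_const _
      · rw [bg.integral_add_mul_dive_flux (sol.contDiffUpTo_slice hs.1) (hχγ s hs.1)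
          (sol.flux_diff s hs.1) (sol.bddContOn_dive_flux bg.isCompact_closure hs.1), mul_zero]
  rw [energy_eq_form, energy_eq_form, eq_of_hasDerivWithinAt_zero (convex_Icc 0 t) hderiv
    (right_mem_Icc.2 ht) (left_mem_Icc.2 ht)]

theorem enstrophy_eq_initial (sol : IsSolution lam σ Ω Ae B χ) (bg : Background Ω Ae B)
    (hI : Integrability Ω Ae B) {γ : ℝ} (hχγ : ∀ t, 0 ≤ t → ∀ x ∈ frontier Ω, χ t x + γ = 0)
    {W : ℝ → ℝ} (hW : ContDiff ℝ 1 W) {t : ℝ} (ht : 0 ≤ t) :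
    enstrophy lam σ Ω Ae B W (χ t) = enstrophy lam σ Ω Ae B W (χ 0) := by
  obtain ⟨M, hM⟩ := sol.exists_dive_flux_bound bg.isCompact_closure t
  refine eq_of_hasDerivWithinAt_zero (f := fun s => enstrophy lam σ Ω Ae B W (χ s))
    (convex_Icc 0 t) (fun s hs => ?_) (right_mem_Icc.2 ht) (left_mem_Icc.2 ht)
  refine (bg.hasDerivWithinAt_integral_density_mul_comp hW hs
    (D := fun s => opD lam σ Ae B (χ s))
    (fun r hr => bg.bddContOn_opD lam σ (sol.contDiffUpTo_slice hr.1))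
    (fun x hx r hr => (sol.equation r hr.1 x hx).mono Icc_subset_Ici_self) hM).congr_deriv ?_
  exact bg.integral_deriv_potentialVorticity_mul_dive_flux lam hI (sol.contDiffUpTo_slice hs.1)
    (hχγ s hs.1) (sol.flux_diff s hs.1) (sol.bddContOn_dive_flux bg.isCompact_closure hs.1) hW

end IsSolution

/-! ### The Bregman divergence -/

/-- The Bregman divergence of `W`: the excess at `b` of `W` over its tangent line at `a`. -/
def bregman (W : ℝ → ℝ) (a b : ℝ) : ℝ :=
  W b - W a - deriv W a * (b - a)

theorem bregman_neg (W : ℝ → ℝ) (a b : ℝ) : bregman (fun s => -W s) a b = -bregman W a b := by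
  simp only [bregman, deriv.fun_neg]
  ring

theorem bregman_nonneg_of_convexOn {W : ℝ → ℝ} (hW : ConvexOn ℝ univ W) {a : ℝ}
    (ha : DifferentiableAt ℝ W a) (b : ℝ) : 0 ≤ bregman W a b := by
  rw [bregman]
  rcases lt_trichotomy a b with hab | rfl | hba
  · have hslope := hW.deriv_le_slope (mem_univ a) (mem_univ b) hab ha
    rw [slope_def_field, le_div_iff₀ (sub_pos.2 hab)] at hslope
    linarith
  · simp
  · have hslope := hW.slope_le_deriv (mem_univ b) (mem_univ a) hba ha
    rw [slope_def_field, div_le_iff₀ (sub_pos.2 hba)] at hslope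
    linarith

theorem mul_sq_le_bregman {W : ℝ → ℝ} {c : ℝ} (hW : Differentiable ℝ W)
    (hW' : Differentiable ℝ (deriv W)) (hc : ∀ s, c ≤ deriv (deriv W) s) (a b : ℝ) :
    c / 2 * (b - a) ^ 2 ≤ bregman W a b := by
  let V : ℝ → ℝ := fun s => W s - c / 2 * s ^ 2
  have hVderiv : ∀ s, HasDerivAt V (deriv W s - c * s) s := fun s =>
    ((hW s).hasDerivAt.sub (((hasDerivAt_id s).pow 2).const_mul (c / 2))).congr_deriv
      (by simp; ring)
  have hV' : deriv V = fun s => deriv W s - c * s := funext fun s => (hVderiv s).deriv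
  have hV'deriv : ∀ s, HasDerivAt (deriv V) (deriv (deriv W) s - c * 1) s := fun s => by
    rw [hV']
    exact (hW' s).hasDerivAt.sub ((hasDerivAt_id s).const_mul c)
  have hconvex : ConvexOn ℝ univ V := convexOn_univ_of_deriv2_nonneg
    (fun s => (hVderiv s).differentiableAt) (fun s => (hV'deriv s).differentiableAt)
    fun s => by simpa [(hV'deriv s).deriv] using hc s
  have hnonneg := bregman_nonneg_of_convexOn hconvex (hVderiv a).differentiableAt b
  simp only [bregman, hV', V] at hnonneg ⊢
  linarith

theorem bregman_le_mul_sq {W : ℝ → ℝ} {c : ℝ} (hW : Differentiable ℝ W)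
    (hW' : Differentiable ℝ (deriv W)) (hc : ∀ s, deriv (deriv W) s ≤ c) (a b : ℝ) :
    bregman W a b ≤ c / 2 * (b - a) ^ 2 := by
  have hneg : deriv (fun s => -W s) = fun s => -deriv W s := funext fun s => deriv.fun_neg
  have hbound := mul_sq_le_bregman (c := -c) hW.fun_neg (by rw [hneg]; exact hW'.fun_neg)
    (fun s => by rw [hneg, deriv.fun_neg]; exact neg_le_neg (hc s)) a b
  rw [bregman_neg] at hbound
  linarith

/-! ### The Lyapunov functional -/

theorem eventually_one_le_mul_and_le {X : Type*} [TopologicalSpace X] {K : Set X}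
    (hK : IsCompact K) {f : X → ℝ} (hf : ContinuousOn f K) (hpos : ∀ x ∈ K, 0 < f x) :
    ∀ᶠ Λ in atTop, ∀ x ∈ K, 1 ≤ Λ * f x ∧ f x ≤ Λ := by
  obtain ⟨c, hc, hcf⟩ := hK.exists_forall_le' hf hpos
  obtain ⟨C, hC⟩ := hK.exists_bound_of_continuousOn hf
  filter_upwards [eventually_ge_atTop C, eventually_ge_atTop c⁻¹] with Λ hCΛ hcΛ x hx
  refine ⟨?_, (le_abs_self _).trans ((hC x hx).trans hCΛ)⟩
  calc 1 = c⁻¹ * c := (inv_mul_cancel₀ hc.ne').symm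
    _ ≤ Λ * f x := mul_le_mul hcΛ (hcf x hx) hc.le ((inv_pos.2 hc).le.trans hcΛ)

theorem eventually_setIntegral_mul_bounds {X : Type*} [TopologicalSpace X] [MeasurableSpace X]
    [OpensMeasurableSpace X] {μ : Measure X} {s : Set X} (hs : MeasurableSet s) (hμ : μ s ≠ ⊤)
    (hsc : IsCompact (closure s)) {p : X → ℝ} (hp : ContinuousOn p (closure s))
    (hpos : ∀ x ∈ closure s, 0 < p x) :
    ∀ᶠ Λ in atTop, ∀ f, BddContOn f s → (∀ x, 0 ≤ f x) →
      ∫ x in s, f x ∂μ ≤ Λ * ∫ x in s, p x * f x ∂μ ∧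
      ∫ x in s, p x * f x ∂μ ≤ Λ * ∫ x in s, f x ∂μ := by
  filter_upwards [eventually_one_le_mul_and_le hsc hp hpos] with Λ hΛ f hf hf0
  have hpf := (BddContOn.of_continuousOn_closure hp hsc).mul hf
  simp only [← integral_const_mul]
  constructor
  · refine setIntegral_mono_on (hf.integrableOn hs hμ) ((hpf.const_mul Λ).integrableOn hs hμ) hs
      fun x hx => ?_
    rw [← mul_assoc]
    exact le_mul_of_one_le_left (hf0 x) (hΛ x (subset_closure hx)).1
  · exact setIntegral_mono_on (hpf.integrableOn hs hμ) ((hf.const_mul Λ).integrableOn hs hμ) hs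
      fun x hx => mul_le_mul_of_nonneg_right (hΛ x (subset_closure hx)).2 (hf0 x)

/-- The standing assumption on the Casimir density `W = ν w`: in the integrable case it is uniformly
convex with bounded second derivative, otherwise no Casimir is available and `W = 0`. -/
structure IsAdmissible (Ω : Set E3) (Ae : E3 → ℝ) (B : E3 → E3) (cm cM : ℝ) (W : ℝ → ℝ) :
    Prop where
  differentiable : Differentiable ℝ W
  differentiable_deriv : Differentiable ℝ (deriv W)
  pos_of_integrability : Integrability Ω Ae B → 0 < cm
  deriv_deriv_mem_Icc : Integrability Ω Ae B → ∀ s, deriv (deriv W) s ∈ Icc cm cM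
  eq_zero : ¬ Integrability Ω Ae B → W = 0

/-- The relative energy-Casimir functional of `χ` with respect to `χ₀`, in which `W_Ω` is replaced
by its remainder beyond first order. -/
def lyapunov (lam σ : ℝ) (Ω : Set E3) (Ae : E3 → ℝ) (B : E3 → E3) (W : ℝ → ℝ) (χ₀ χ : E3 → ℝ) :
    ℝ :=
  energy lam σ Ω Ae B (fun x => χ x - χ₀ x) + ∫ x in Ω, Ae x *
    bregman W (potentialVorticity lam σ Ae B χ₀ x) (potentialVorticity lam σ Ae B χ x)

theorem isAdmissible_const_mul {Ω : Set E3} {Ae : E3 → ℝ} {B : E3 → E3} {ν cm cM : ℝ} {w : ℝ → ℝ}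
    (hint : Integrability Ω Ae B → Differentiable ℝ w ∧ Differentiable ℝ (deriv w) ∧ 0 < cm ∧
      ∀ s, cm ≤ ν * deriv (deriv w) s ∧ ν * deriv (deriv w) s ≤ cM)
    (hnonint : ¬ Integrability Ω Ae B → ν = 0) :
    IsAdmissible Ω Ae B cm cM fun s => ν * w s := by
  have hderiv : deriv (fun s => ν * w s) = fun s => ν * deriv w s :=
    funext fun s => deriv_const_mul_field ν
  by_cases hI : Integrability Ω Ae B
  · obtain ⟨hw, hw', hcm, hbounds⟩ := hint hI
    exact ⟨hw.const_mul ν, hderiv ▸ hw'.const_mul ν, fun _ => hcm,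
      fun _ s => by simpa only [hderiv, deriv_const_mul_field, mem_Icc] using hbounds s,
      fun h => absurd hI h⟩
  · have hzero : (fun s => ν * w s) = 0 := funext fun s => by simp [hnonint hI]
    rw [hzero]
    exact ⟨differentiable_const 0, by simp, fun h => absurd h hI, fun h => absurd h hI,
      fun _ => rfl⟩

namespace IsAdmissible

variable {Ω : Set E3} {Ae : E3 → ℝ} {B : E3 → E3} {cm cM : ℝ} {W : ℝ → ℝ}

theorem contDiff (hW : IsAdmissible Ω Ae B cm cM W) : ContDiff ℝ 1 W :=
  contDiff_one_iff_deriv.2 ⟨hW.differentiable, hW.differentiable_deriv.continuous⟩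

theorem shiftedCasimir_eq_initial (hW : IsAdmissible Ω Ae B cm cM W) (bg : Background Ω Ae B)
    {lam σ γ : ℝ} {χ : ℝ → E3 → ℝ} (sol : IsSolution lam σ Ω Ae B χ)
    (hχγ : ∀ t, 0 ≤ t → ∀ x ∈ frontier Ω, χ t x + γ = 0) {t : ℝ} (ht : 0 ≤ t) :
    shiftedCasimir lam σ Ω Ae B γ W (χ t) = shiftedCasimir lam σ Ω Ae B γ W (χ 0) := by
  rw [shiftedCasimir, shiftedCasimir, sol.energy_eq_initial bg hχγ ht]
  by_cases hI : Integrability Ω Ae B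
  · rw [sol.enstrophy_eq_initial bg hI hχγ hW.contDiff ht]
  · simp [hW.eq_zero hI, enstrophy]

end IsAdmissible

namespace Background

variable {Ω : Set E3} {Ae : E3 → ℝ} {B : E3 → E3} {χ₀ χ : E3 → ℝ} {W : ℝ → ℝ}

theorem opD_sub (bg : Background Ω Ae B) (lam σ : ℝ) (hχ : ContDiffUpTo 2 χ Ω)
    (hχ₀ : ContDiffUpTo 2 χ₀ Ω) {x : E3} (hx : x ∈ Ω) :
    opD lam σ Ae B (fun y => χ y - χ₀ y) x = opD lam σ Ae B χ x - opD lam σ Ae B χ₀ x := by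
  simpa [← sub_eq_add_neg] using bg.opD_add_mul lam σ hχ hχ₀ (-1) hx

theorem energy_sub (bg : Background Ω Ae B) (lam σ γ : ℝ) (hχ : ContDiffUpTo 2 χ Ω)
    (hχ₀ : ContDiffUpTo 2 χ₀ Ω) :
    energy lam σ Ω Ae B (fun x => χ x - χ₀ x) =
      energy lam σ Ω Ae B (fun x => χ x + γ) - energy lam σ Ω Ae B (fun x => χ₀ x + γ) -
        form lam σ Ω Ae B (fun x => χ₀ x + γ) (fun x => χ x - χ₀ x) := by
  have hexpand := bg.form_add_mul_self lam σ (hχ₀.add_const γ) (hχ.sub hχ₀) 1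
  have hχγ : (fun x => χ₀ x + γ + 1 * (χ x - χ₀ x)) = fun x => χ x + γ := funext fun x => by ring
  rw [hχγ] at hexpand
  simp only [energy_eq_form]
  linarith

theorem bddContOn_bregman (bg : Background Ω Ae B) (lam σ : ℝ) (hW : ContDiff ℝ 1 W)
    (hχ₀ : ContDiffUpTo 2 χ₀ Ω) (hχ : ContDiffUpTo 2 χ Ω) :
    BddContOn (fun x => Ae x * bregman W (potentialVorticity lam σ Ae B χ₀ x)
      (potentialVorticity lam σ Ae B χ x)) Ω := by
  have hq := bg.bddContOn_potentialVorticity lam σ hχ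
  have hq₀ := bg.bddContOn_potentialVorticity lam σ hχ₀
  exact bg.bddContOn_density.mul (((hq.comp hW.continuous).sub (hq₀.comp hW.continuous)).sub
    ((hq₀.comp (hW.continuous_deriv le_rfl)).mul (hq.sub hq₀)))

theorem integral_bregman (bg : Background Ω Ae B) (lam σ : ℝ) (hW : ContDiff ℝ 1 W)
    (hχ₀ : ContDiffUpTo 2 χ₀ Ω) (hχ : ContDiffUpTo 2 χ Ω) :
    ∫ x in Ω, Ae x * bregman W (potentialVorticity lam σ Ae B χ₀ x)
        (potentialVorticity lam σ Ae B χ x) =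
      enstrophy lam σ Ω Ae B W χ - enstrophy lam σ Ω Ae B W χ₀ -
        ∫ x in Ω, deriv W (potentialVorticity lam σ Ae B χ₀ x) *
          opD lam σ Ae B (fun y => χ y - χ₀ y) x := by
  have hq := bg.bddContOn_density.mul
    ((bg.bddContOn_potentialVorticity lam σ hχ).comp hW.continuous)
  have hq₀ := bg.bddContOn_density.mul
    ((bg.bddContOn_potentialVorticity lam σ hχ₀).comp hW.continuous)
  have hlinear := ((bg.bddContOn_potentialVorticity lam σ hχ₀).comp
    (hW.continuous_deriv le_rfl)).mul (bg.bddContOn_opD lam σ (hχ.sub hχ₀))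
  simp only [potentialVorticity] at hq hq₀ hlinear ⊢
  rw [enstrophy, enstrophy, ← integral_sub (bg.integrableOn hq) (bg.integrableOn hq₀),
    ← integral_sub (bg.integrableOn (hq.sub hq₀)) (bg.integrableOn hlinear)]
  refine setIntegral_congr_fun bg.measurableSet fun x hx => ?_
  have hAe := bg.density_ne_zero hx
  simp only [bregman, bg.opD_sub lam σ hχ hχ₀ hx]
  field_simp

theorem lyapunov_eq_shiftedCasimir_sub (bg : Background Ω Ae B) {lam σ γ ν : ℝ} {w : ℝ → ℝ}
    (hw : ContDiff ℝ 1 fun s => ν * w s) (hχ₀ : ContDiffUpTo 2 χ₀ Ω)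
    (hcrit : IsCritical lam σ Ω Ae B γ ν w χ₀) (hχ : ContDiffUpTo 2 χ Ω)
    (hχχ₀ : ∀ x ∈ frontier Ω, χ x - χ₀ x = 0) :
    lyapunov lam σ Ω Ae B (fun s => ν * w s) χ₀ χ =
      shiftedCasimir lam σ Ω Ae B γ (fun s => ν * w s) χ -
        shiftedCasimir lam σ Ω Ae B γ (fun s => ν * w s) χ₀ := by
  have hEL := bg.eulerLagrange_of_isCritical hw hχ₀ hcrit (hχ.sub hχ₀) hχχ₀
  rw [lyapunov, bg.energy_sub lam σ γ hχ hχ₀, bg.integral_bregman lam σ hw hχ₀ hχ,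
    shiftedCasimir, shiftedCasimir]
  linarith

theorem eventually_energy_bounds (bg : Background Ω Ae B) {lam σ : ℝ} (hlam : 0 < lam)
    (hσ : 0 < σ) : ∀ᶠ Λ in atTop, ∀ u, ContDiffUpTo 2 u Ω →
      (∫ x in Ω, u x ^ 2) + (∫ x in Ω, ‖gradPerp B u x‖ ^ 2) ≤ Λ * energy lam σ Ω Ae B u ∧
      energy lam σ Ω Ae B u ≤
        Λ * ((∫ x in Ω, u x ^ 2) + ∫ x in Ω, ‖gradPerp B u x‖ ^ 2) := by
  let p : E3 → ℝ := fun x => lam / 2 * Ae x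
  let r : E3 → ℝ := fun x => σ / 2 * (Ae x / ‖B x‖ ^ 2)
  have hAe := bg.contDiffUpTo_density.1
  have hp : ContinuousOn p (closure Ω) := continuousOn_const.mul hAe
  have hr : ContinuousOn r (closure Ω) := continuousOn_const.mul
    (hAe.div (bg.contDiffUpTo_field.1.norm.pow 2)
      fun x hx => pow_ne_zero 2 (bg.norm_field_pos x hx).ne')
  filter_upwards [
    eventually_setIntegral_mul_bounds bg.measurableSet bg.volume_ne_top bg.isCompact_closure hp
      fun x hx => mul_pos (half_pos hlam) (bg.density_pos x hx),
    eventually_setIntegral_mul_bounds bg.measurableSet bg.volume_ne_top bg.isCompact_closure hr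
      fun x hx => mul_pos (half_pos hσ)
        (div_pos (bg.density_pos x hx) (pow_pos (bg.norm_field_pos x hx) 2))] with Λ hpΛ hrΛ u hu
  have hu2 : BddContOn (fun x => u x ^ 2) Ω := (bg.bddC1On hu).bddContOn.comp (continuous_pow 2)
  have hg2 : BddContOn (fun x => ‖gradPerp B u x‖ ^ 2) Ω :=
    (bg.bddC1On_gradPerp hu).bddContOn.comp (continuous_norm.pow 2)
  have henergy : energy lam σ Ω Ae B u =
      (∫ x in Ω, p x * u x ^ 2) + ∫ x in Ω, r x * ‖gradPerp B u x‖ ^ 2 := by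
    rw [energy, ← integral_const_mul, ← integral_add
      (bg.integrableOn ((BddContOn.of_continuousOn_closure hp bg.isCompact_closure).mul hu2))
      (bg.integrableOn ((BddContOn.of_continuousOn_closure hr bg.isCompact_closure).mul hg2))]
    congr 1 with x
    ring
  obtain ⟨hu_le, hle_u⟩ := hpΛ _ hu2 fun x => sq_nonneg (u x)
  obtain ⟨hg_le, hle_g⟩ := hrΛ _ hg2 fun x => sq_nonneg ‖gradPerp B u x‖
  rw [henergy, mul_add, mul_add]
  exact ⟨add_le_add hu_le hg_le, add_le_add hle_u hle_g⟩

theorem div_density_mul_opD_sub_sq (bg : Background Ω Ae B) (lam σ c : ℝ)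
    (hχ : ContDiffUpTo 2 χ Ω) (hχ₀ : ContDiffUpTo 2 χ₀ Ω) {x : E3} (hx : x ∈ Ω) :
    c / Ae x * opD lam σ Ae B (fun y => χ y - χ₀ y) x ^ 2 =
      Ae x *
        (c * (potentialVorticity lam σ Ae B χ x - potentialVorticity lam σ Ae B χ₀ x) ^ 2) := by
  have hAe := bg.density_ne_zero hx
  rw [bg.opD_sub lam σ hχ hχ₀ hx, potentialVorticity, potentialVorticity]
  field_simp

theorem eventually_integral_bregman_bounds (bg : Background Ω Ae B) (lam σ : ℝ) {cm cM : ℝ}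
    (hW : Differentiable ℝ W) (hW' : Differentiable ℝ (deriv W)) (hcm : 0 < cm)
    (hbounds : ∀ s, deriv (deriv W) s ∈ Icc cm cM) (hχ₀ : ContDiffUpTo 2 χ₀ Ω) :
    ∀ᶠ Λ in atTop, ∀ χ, ContDiffUpTo 2 χ Ω →
      ∫ x in Ω, opD lam σ Ae B (fun y => χ y - χ₀ y) x ^ 2 ≤
        Λ * (∫ x in Ω, Ae x * bregman W (potentialVorticity lam σ Ae B χ₀ x)
          (potentialVorticity lam σ Ae B χ x)) ∧
      ∫ x in Ω, Ae x * bregman W (potentialVorticity lam σ Ae B χ₀ x)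
          (potentialVorticity lam σ Ae B χ x) ≤
        Λ * ∫ x in Ω, opD lam σ Ae B (fun y => χ y - χ₀ y) x ^ 2 := by
  have hcM : 0 < cM := hcm.trans_le ((hbounds 0).1.trans (hbounds 0).2)
  have hcont : ∀ c : ℝ, ContinuousOn (fun x => c / 2 / Ae x) (closure Ω) := fun c =>
    continuousOn_const.div bg.contDiffUpTo_density.1 fun x hx => (bg.density_pos x hx).ne'
  have hpos : ∀ {c : ℝ}, 0 < c → ∀ x ∈ closure Ω, 0 < c / 2 / Ae x := fun hc x hx =>
    div_pos (half_pos hc) (bg.density_pos x hx)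
  filter_upwards [eventually_ge_atTop 0,
    eventually_setIntegral_mul_bounds bg.measurableSet bg.volume_ne_top bg.isCompact_closure
      (hcont cm) (hpos hcm),
    eventually_setIntegral_mul_bounds bg.measurableSet bg.volume_ne_top bg.isCompact_closure
      (hcont cM) (hpos hcM)] with Λ hΛ hmΛ hMΛ χ hχ
  have hD2 : BddContOn (fun x => opD lam σ Ae B (fun y => χ y - χ₀ y) x ^ 2) Ω :=
    (bg.bddContOn_opD lam σ (hχ.sub hχ₀)).comp (continuous_pow 2)
  have hbregman := bg.integrableOn (bg.bddContOn_bregman lam σ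
    (contDiff_one_iff_deriv.2 ⟨hW, hW'.continuous⟩) hχ₀ hχ)
  have hweight : ∀ c : ℝ, IntegrableOn
      (fun x => c / 2 / Ae x * opD lam σ Ae B (fun y => χ y - χ₀ y) x ^ 2) Ω := fun c =>
    bg.integrableOn ((BddContOn.of_continuousOn_closure (hcont c) bg.isCompact_closure).mul hD2)
  constructor
  · refine (hmΛ _ hD2 fun x => sq_nonneg _).1.trans (mul_le_mul_of_nonneg_left ?_ hΛ)
    refine setIntegral_mono_on (hweight cm) hbregman bg.measurableSet fun x hx => ?_
    rw [bg.div_density_mul_opD_sub_sq lam σ (cm / 2) hχ hχ₀ hx]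
    exact mul_le_mul_of_nonneg_left (mul_sq_le_bregman hW hW' (fun s => (hbounds s).1) _ _)
      (bg.density_pos x (subset_closure hx)).le
  · refine le_trans ?_ (hMΛ _ hD2 fun x => sq_nonneg _).2
    refine setIntegral_mono_on hbregman (hweight cM) bg.measurableSet fun x hx => ?_
    rw [bg.div_density_mul_opD_sub_sq lam σ (cM / 2) hχ hχ₀ hx]
    exact mul_le_mul_of_nonneg_left (bregman_le_mul_sq hW hW' (fun s => (hbounds s).2) _ _)
      (bg.density_pos x (subset_closure hx)).le

end Background

theorem IsAdmissible.eventually_lyapunov_bounds {Ω : Set E3} {Ae : E3 → ℝ} {B : E3 → E3}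
    {cm cM : ℝ} {W : ℝ → ℝ} (hW : IsAdmissible Ω Ae B cm cM W) (bg : Background Ω Ae B)
    {lam σ : ℝ} (hlam : 0 < lam) (hσ : 0 < σ) {χ₀ : E3 → ℝ} (hχ₀ : ContDiffUpTo 2 χ₀ Ω) :
    ∀ᶠ Λ in atTop, ∀ χ, ContDiffUpTo 2 χ Ω →
      normPerpSq lam σ Ω Ae B (fun x => χ x - χ₀ x) ≤ Λ * lyapunov lam σ Ω Ae B W χ₀ χ ∧
      lyapunov lam σ Ω Ae B W χ₀ χ ≤ Λ * normPerpSq lam σ Ω Ae B (fun x => χ x - χ₀ x) := by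
  by_cases hI : Integrability Ω Ae B
  · filter_upwards [bg.eventually_energy_bounds hlam hσ,
      bg.eventually_integral_bregman_bounds lam σ hW.differentiable hW.differentiable_deriv
        (hW.pos_of_integrability hI) (hW.deriv_deriv_mem_Icc hI) hχ₀]
      with Λ henergy hbregman χ hχ
    obtain ⟨hnorm_le, hle_norm⟩ := henergy _ (hχ.sub hχ₀)
    obtain ⟨hopD_le, hle_opD⟩ := hbregman χ hχ
    simp only [normPerpSq, if_pos hI, lyapunov, mul_add] at hle_norm ⊢
    exact ⟨add_le_add hnorm_le hopD_le, add_le_add hle_norm hle_opD⟩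
  · filter_upwards [bg.eventually_energy_bounds hlam hσ] with Λ henergy χ hχ
    simpa [normPerpSq, hI, lyapunov, hW.eq_zero hI, bregman] using henergy _ (hχ.sub hχ₀)

end GHM

end

theorem theorem1
    (lam σ : ℝ) (hlam : 0 < lam) (hσ : 0 < σ)
    (Ω : Set GHM.E3) (hΩo : IsOpen Ω) (hΩb : Bornology.IsBounded Ω)
    (Ae : GHM.E3 → ℝ) (B : GHM.E3 → GHM.E3)
    (hAe : GHM.ContDiffUpTo 2 Ae Ω) (hB : GHM.ContDiffUpTo 2 B Ω)
    (hAepos : ∀ x ∈ closure Ω, 0 < Ae x) (hBpos : ∀ x ∈ closure Ω, 0 < ‖B x‖)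
    (γ ν : ℝ) (w : ℝ → ℝ) (cm cM : ℝ)
    (hint : GHM.Integrability Ω Ae B →
      Differentiable ℝ w ∧ Differentiable ℝ (deriv w) ∧ 0 < cm ∧
        ∀ s, cm ≤ ν * deriv (deriv w) s ∧ ν * deriv (deriv w) s ≤ cM)
    (hnonint : ¬ GHM.Integrability Ω Ae B → ν = 0)
    (χ₀ : GHM.E3 → ℝ) (hχ₀ : GHM.ContDiffUpTo 2 χ₀ Ω)
    (hcrit : GHM.IsCritical lam σ Ω Ae B γ ν w χ₀)
    (hbd : ∀ x ∈ frontier Ω, Ae x * (χ₀ x + γ) = 0) :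
    ∃ C : ℝ, 0 < C ∧
      ∀ χ : ℝ → GHM.E3 → ℝ, GHM.IsSolution lam σ Ω Ae B χ →
        (∀ t, 0 ≤ t → ∀ x ∈ frontier Ω, χ t x - χ₀ x = 0) →
        ∀ t, 0 ≤ t →
          GHM.normPerpSq lam σ Ω Ae B (fun x => χ t x - χ₀ x) ≤
            C * GHM.normPerpSq lam σ Ω Ae B (fun x => χ 0 x - χ₀ x) := by
  have bg : GHM.Background Ω Ae B := ⟨hΩo, hΩb, hAe, hB, hAepos, hBpos⟩
  have hW := GHM.isAdmissible_const_mul hint hnonint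
  obtain ⟨Λ, hbounds, hΛ⟩ := ((hW.eventually_lyapunov_bounds bg hlam hσ hχ₀).and
    (Filter.eventually_gt_atTop 0)).exists
  refine ⟨Λ * Λ, mul_pos hΛ hΛ, fun χ sol hχχ₀ t ht => ?_⟩
  have hχγ : ∀ s, 0 ≤ s → ∀ x ∈ frontier Ω, χ s x + γ = 0 := fun s hs x hx => by
    have hχ₀γ := (mul_eq_zero.1 (hbd x hx)).resolve_left
      (hAepos x (frontier_subset_closure hx)).ne'
    rw [sub_eq_zero.1 (hχχ₀ s hs x hx), hχ₀γ]
  have hχ : ∀ s, 0 ≤ s → GHM.ContDiffUpTo 2 (χ s) Ω := fun s => sol.contDiffUpTo_slice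
  have hconserved : GHM.lyapunov lam σ Ω Ae B (fun s => ν * w s) χ₀ (χ t) =
      GHM.lyapunov lam σ Ω Ae B (fun s => ν * w s) χ₀ (χ 0) := by
    rw [bg.lyapunov_eq_shiftedCasimir_sub hW.contDiff hχ₀ hcrit (hχ t ht) (hχχ₀ t ht),
      bg.lyapunov_eq_shiftedCasimir_sub hW.contDiff hχ₀ hcrit (hχ 0 le_rfl) (hχχ₀ 0 le_rfl),
      hW.shiftedCasimir_eq_initial bg sol hχγ ht]
  calc GHM.normPerpSq lam σ Ω Ae B (fun x => χ t x - χ₀ x)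
      ≤ Λ * GHM.lyapunov lam σ Ω Ae B (fun s => ν * w s) χ₀ (χ t) := (hbounds _ (hχ t ht)).1
    _ = Λ * GHM.lyapunov lam σ Ω Ae B (fun s => ν * w s) χ₀ (χ 0) := by rw [hconserved]
    _ ≤ Λ * (Λ * GHM.normPerpSq lam σ Ω Ae B (fun x => χ 0 x - χ₀ x)) :=
        mul_le_mul_of_nonneg_left (hbounds _ (hχ 0 le_rfl)).2 hΛ.le
    _ = Λ * Λ * GHM.normPerpSq lam σ Ω Ae B (fun x => χ 0 x - χ₀ x) := (mul_assoc _ _ _).symm
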